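/- Let $K$ be a field, let $\sigma$ be an automorphism of $K$ of finite order $n$ with $n$ prime, let $F=\mathrm{Fix}(\sigma)$, and let $R=K[t;\sigma]$ be the skew polynomial ring with multiplication determined by $ta=\sigma(a)t$ for $a\in K$. Let $f\in R$ be monic of degree $m\ge 1$ such that the greatest common right divisor of $f$ and $t$ is $1$. Let $h(t)=\hat h(t^n)$, with $\hat h\in F[x]$ monic, be the minimal central left multiple of $f$, i.e. the nonzero polynomial of minimal degree in the center $F[t^n]$ of $R$, so normalised, that lies in $Rf$, and suppose that $\hat h$ is square-free (for example, irreducible) in $F[x]$. The eigenring of $f$ is the $F$-algebra $\mathcal E(f)=\{g\in R: fg\in Rf\}/Rf$, and $f$ is called a generalised A-polynomial if $\mathcal E(f)$ is a (finite-dimensional) central simple algebra over $F$. For $v\in K^\times$ and $\alpha \in K$ put $\Omega_v(\alpha)=\sigma(v)\alpha v^{-1}$. Then $f$ is a generalised A-polynomial if and only if one of the following holds: (i) there exists $a\in F^\times$ such that $a\ne N_{K/F}(b)$ for every $b\in K$, and $f(t)=t^n-a$; (ii) $m\le n$ and there exist $c_1,\dots,c_m,b\in K^\times$ with $c_m=1$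 such that $$f(t)=\prod_{i=1}^m\bigl(t-\Omega_{c_i}(b)\bigr)=(t-\Omega_{c_1}(b))\cdots(t-\Omega_{c_m}(b)).$$ Moreover, in case (i) $f$ is irreducible in $R$. -/

import Mathlib

/-!
# Skew polynomial rings `K[t;σ]`, eigenrings and generalised A-polynomials
-/

noncomputable section

/-! ## The skew polynomial ring `K[t;σ]` -/

/-- A copy of the field `K` that remembers the automorphism `σ`; it carries the action
`(k, a) ↦ σ ^ k a` of the additive monoid `ℕ`, through which Mathlib's skew polynomial ring
is twisted. -/
def TwistedField {K : Type*} [Field K] (_σ : K ≃+* K) : Type _ := K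

instance TwistedField.instField {K : Type*} [Field K] (σ : K ≃+* K) : Field (TwistedField σ) :=
  inferInstanceAs (Field K)

instance TwistedField.instMulSemiringAction {K : Type*} [Field K] (σ : K ≃+* K) :
    MulSemiringAction (Multiplicative ℕ) (TwistedField σ) where
  smul k a := (σ ^ Multiplicative.toAdd k : K ≃+* K) a
  one_smul _ := rfl
  mul_smul k l a := by
    change (σ ^ (Multiplicative.toAdd k + Multiplicative.toAdd l) : K ≃+* K) a = _
    rw [pow_add]
    rfl
  smul_zero k := map_zero (σ ^ Multiplicative.toAdd k : K ≃+* K)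
  smul_add k := map_add (σ ^ Multiplicative.toAdd k : K ≃+* K)
  smul_one k := map_one (σ ^ Multiplicative.toAdd k : K ≃+* K)
  smul_mul k := map_mul (σ ^ Multiplicative.toAdd k : K ≃+* K)

/-- The identity map from `K` to its copy `TwistedField σ`. -/
def TwistedField.of {K : Type*} [Field K] (σ : K ≃+* K) : K ≃+* TwistedField σ :=
  RingEquiv.refl K

/-- The endomorphism that twists the multiplication is `σ`. -/
theorem TwistedField.phi_of {K : Type*} [Field K] (σ : K ≃+* K) (a : K) :
    (SkewPolynomial.φ : TwistedField σ →+* TwistedField σ) (of σ a) = of σ (σ a) := rfl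

/-- The skew polynomial ring `K[t;σ]`: polynomials `∑ aᵢ tⁱ` with coefficients on the left, usual
addition, and multiplication determined by `t a = σ(a) t`. -/
abbrev SkewPoly {K : Type*} [Field K] (σ : K ≃+* K) : Type _ := SkewPolynomial (TwistedField σ)

namespace SkewPoly

/-- The indeterminate `t` of `K[t;σ]`. -/
abbrev t {K : Type*} [Field K] (σ : K ≃+* K) : SkewPoly σ := SkewPolynomial.X

/-- The embedding of `K` into `K[t;σ]` as constant polynomials. -/
def const {K : Type*} [Field K] (σ : K ≃+* K) : K →+* SkewPoly σ :=
  (SkewPolynomial.CRingHom : TwistedField σ →+* SkewPolynomial (TwistedField σ)).comp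
    (TwistedField.of σ : K →+* TwistedField σ)

/-- Constants as monomials of degree `0`. -/
theorem const_eq_monomial {K : Type*} [Field K] (σ : K ≃+* K) (a : K) :
    const σ a = SkewPolynomial.monomial 0 (TwistedField.of σ a) := rfl

/-- The defining commutation rule `t a = σ(a) t`. -/
theorem t_mul_const {K : Type*} [Field K] (σ : K ≃+* K) (a : K) :
    t σ * const σ a = const σ (σ a) * t σ := by
  rw [const_eq_monomial, const_eq_monomial, SkewPolynomial.X_mul_monomial,
    SkewPolynomial.monomial_mul_X, TwistedField.phi_of]

/-- The degree of a skew polynomial (with value `0` at the zero polynomial). -/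
def natDegree {K : Type*} [Field K] {σ : K ≃+* K} (f : SkewPoly σ) : ℕ :=
  (SkewPolynomial.support f).sup id

/-- A skew polynomial is monic if its leading coefficient is `1`. -/
def IsMonic {K : Type*} [Field K] {σ : K ≃+* K} (f : SkewPoly σ) : Prop :=
  SkewPolynomial.coeff f (natDegree f) = 1

/-- The fixed field `F = Fix(σ)`. -/
def fixedField {K : Type*} [Field K] (σ : K ≃+* K) : Subfield K :=
  RingHom.eqLocusField (σ : K →+* K) (RingHom.id K)

/-- Constants in the fixed field of `σ` are central in `K[t;σ]`. -/
theorem const_fixed_commutes {K : Type*} [Field K] (σ : K ≃+* K) (a : fixedField σ)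
    (p : SkewPoly σ) : const σ (a : K) * p = p * const σ (a : K) := by
  have ha : ∀ k : ℕ, (SkewPolynomial.φ : TwistedField σ →+* TwistedField σ)^[k]
      (TwistedField.of σ (a : K)) = TwistedField.of σ (a : K) := by
    intro k
    refine Function.iterate_fixed ?_ k
    rw [TwistedField.phi_of]
    exact congrArg (TwistedField.of σ) a.2
  rw [const_eq_monomial]
  induction p using SkewPolynomial.induction with
  | h0 => simp only [mul_zero, zero_mul]
  | ha n r q _ _ hq =>
    rw [mul_add, add_mul, hq, SkewPolynomial.monomial_mul_monomial,
      SkewPolynomial.monomial_mul_monomial, ha n, zero_add, add_zero, Function.iterate_zero, id_eq,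
      mul_comm]

/-- `K[t;σ]` is an algebra over `F = Fix(σ)`, through the constant polynomials. -/
instance instAlgebraFixedField {K : Type*} [Field K] (σ : K ≃+* K) :
    Algebra (fixedField σ) (SkewPoly σ) :=
  RingHom.toAlgebra' ((const σ).comp (fixedField σ).subtype) (const_fixed_commutes σ)

/-- `(f, g)_r = 1`: every common right divisor of `f` and `g` is a unit. -/
def IsRightCoprime {K : Type*} [Field K] {σ : K ≃+* K} (f g : SkewPoly σ) : Prop :=
  ∀ d : SkewPoly σ, f ∈ Ideal.span {d} → g ∈ Ideal.span {d} → IsUnit d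

/-- `ĥ ∈ F[x]` is the monic polynomial for which `h = ĥ(tⁿ)` is the minimal central left multiple
of `f`: a polynomial of minimal degree among the nonzero central elements of `K[t;σ]`
that lie in `K[t;σ] f`. Here `n` is the order of `σ`. -/
structure IsMinimalCentralLeftMultiple {K : Type*} [Field K] {σ : K ≃+* K} (n : ℕ)
    (f : SkewPoly σ) (hhat : Polynomial (fixedField σ)) : Prop where
  monic : hhat.Monic
  mem_center : Polynomial.aeval (t σ ^ n) hhat ∈ Subring.center (SkewPoly σ)
  left_multiple : Polynomial.aeval (t σ ^ n) hhat ∈ Ideal.span {f}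
  minimal : ∀ z ∈ Subring.center (SkewPoly σ), z ≠ 0 → z ∈ Ideal.span {f} →
    natDegree (Polynomial.aeval (t σ ^ n) hhat) ≤ natDegree z

/-- The map `Ω_v(α) = σ(v) α v⁻¹` on `K`. -/
def Omega {K : Type*} [Field K] (σ : K ≃+* K) (v : Kˣ) (α : K) : K :=
  σ (v : K) * α * (v : K)⁻¹

end SkewPoly

/-! ## Idealisers and eigenrings -/

/-- The idealiser `I(f) = {g ∈ R : f g ∈ R f}`, a subalgebra of `R`. For a noncommutative ring,
`Ideal.span {f}` is the left ideal `R f`. -/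
def idealiser (F : Type*) {R : Type*} [CommRing F] [Ring R] [Algebra F R] (f : R) :
    Subalgebra F R where
  carrier := {g | f * g ∈ Ideal.span {f}}
  mul_mem' := by
    intro a b ha hb
    obtain ⟨q, hq⟩ := Ideal.mem_span_singleton'.mp ha
    change f * (a * b) ∈ Ideal.span {f}
    rw [← mul_assoc, ← hq, mul_assoc]
    exact Ideal.mul_mem_left _ q hb
  add_mem' := by
    intro a b ha hb
    change f * (a + b) ∈ Ideal.span {f}
    rw [mul_add]
    exact Ideal.add_mem _ ha hb
  algebraMap_mem' := by
    intro r
    change f * algebraMap F R r ∈ Ideal.span {f}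
    rw [← Algebra.commutes]
    exact Ideal.mul_mem_left _ _ (Ideal.mem_span_singleton_self f)

/-- The left ideal `R f`, as an ideal of the idealiser `I(f)`. -/
def idealiserIdeal (F : Type*) {R : Type*} [CommRing F] [Ring R] [Algebra F R] (f : R) :
    Ideal (idealiser F f) :=
  Ideal.comap (idealiser F f).val (Ideal.span {f})

instance idealiserIdeal.instIsTwoSided (F : Type*) {R : Type*} [CommRing F] [Ring R] [Algebra F R]
    (f : R) : (idealiserIdeal F f).IsTwoSided where
  mul_mem_of_left := by
    intro a b ha
    obtain ⟨q, hq⟩ := Ideal.mem_span_singleton'.mp (show (a : R) ∈ Ideal.span {f} from ha)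
    change (a : R) * (b : R) ∈ Ideal.span {f}
    rw [← hq, mul_assoc]
    exact Ideal.mul_mem_left _ q b.2

/-- The eigenring `E(f) = I(f) / R f`, an `F`-algebra. -/
abbrev Eigenring (F : Type*) {R : Type*} [CommRing F] [Ring R] [Algebra F R] (f : R) : Type _ :=
  idealiser F f ⧸ idealiserIdeal F f

/-- `f ∈ K[t;σ]` is a generalised A-polynomial if its eigenring is a central simple algebra over
`F = Fix(σ)`: finite-dimensional, with centre `F`, and simple. -/
structure IsGeneralisedAPolynomial {K : Type*} [Field K] {σ : K ≃+* K} (f : SkewPoly σ) :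
    Prop where
  finite : Module.Finite (SkewPoly.fixedField σ) (Eigenring (SkewPoly.fixedField σ) f)
  central : Algebra.IsCentral (SkewPoly.fixedField σ) (Eigenring (SkewPoly.fixedField σ) f)
  simple : IsSimpleRing (Eigenring (SkewPoly.fixedField σ) f)

end

/-! Write R for `SkewPoly σ`. The module V = R/Rf is a K-space of dimension m on which t acts as a
σ-semilinear map T, and right multiplication identifies the eigenring with the R-endomorphisms of V
(in reversed order). Everything is read off from T.

If the eigenring is central, the class of the central element t^n must be a scalar a in F, so f
right-divides t^n - a and m ≤ n. Since f has nonzero constant coefficient, Rf contains no power of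
t, hence a ≠ 0. Two facts about a semilinear T with T^n = a settle the forward direction. First,
determinants give N(det T) = a^dim, so a is a norm whenever the dimension is prime to n
(`exists_prod_eq_of_coprime_finrank`); for n prime and a not a norm, t^n - a therefore has no right
divisor of degree strictly between 0 and n, and f = t^n - a. Second, if a = N(b), the vectors with T
w = b w span V by Galois descent (`span_eigenvectors_eq_top`); a nonzero one splits a factor t -
Ω_c(b) off the left of f, and induction on the degree gives the product.

Conversely, for a not a norm, the eigenring of t^n - a is R/R(t^n - a): it is central by comparing
coefficients and simple by the determinant argument applied to its quotients. In case (ii) each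
linear factor right-divides the central element z = t^n - N(b), so z^m lies in Rf; square-freeness
of `hhat` lowers the exponent to 1, eigenvectors then form a basis of V, and in that basis the
eigenring is the full matrix algebra over F. -/

noncomputable section

namespace SkewPoly

/-! ### Coefficients and the twisted convolution formula -/

section Coefficients

variable {K : Type*} [Field K] {σ : K ≃+* K}

/-- The coefficient of `t ^ i`, as an element of `K`. -/
def cf (p : SkewPoly σ) (i : ℕ) : K :=
  (TwistedField.of σ).symm (SkewPolynomial.coeff p i)

theorem of_cf (p : SkewPoly σ) (i : ℕ) :
    TwistedField.of σ (cf p i) = SkewPolynomial.coeff p i := rfl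

theorem phi_iterate_of (a : K) (k : ℕ) :
    (SkewPolynomial.φ : TwistedField σ →+* TwistedField σ)^[k] (TwistedField.of σ a) =
      TwistedField.of σ ((σ ^ k : K ≃+* K) a) := by
  rw [SkewPolynomial.φ_iterate_apply]; rfl

theorem ext_cf {p q : SkewPoly σ} (h : ∀ i, cf p i = cf q i) : p = q :=
  SkewMonoidAlgebra.ext fun i => h (Multiplicative.toAdd i)

@[simp] theorem cf_zero (i : ℕ) : cf (0 : SkewPoly σ) i = 0 := rfl

@[simp] theorem cf_add (p q : SkewPoly σ) (i : ℕ) : cf (p + q) i = cf p i + cf q i := by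
  simp [cf]

@[simp] theorem cf_sub (p q : SkewPoly σ) (i : ℕ) : cf (p - q) i = cf p i - cf q i := by
  simp [cf]

theorem cf_monomial (k : ℕ) (a : K) (i : ℕ) :
    cf (SkewPolynomial.monomial k (TwistedField.of σ a) : SkewPoly σ) i =
      if k = i then a else 0 := by
  rw [cf, SkewPolynomial.coeff_monomial]; split_ifs <;> simp

theorem const_mul_t_pow (a : K) (k : ℕ) :
    const σ a * t σ ^ k = SkewPolynomial.monomial k (TwistedField.of σ a) := by
  rw [const_eq_monomial, SkewPolynomial.monomial_mul_X_pow, zero_add]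

theorem cf_mul (p q : SkewPoly σ) (k : ℕ) :
    cf (p * q) k = ∑ x ∈ Finset.HasAntidiagonal.antidiagonal k, cf p x.1 * (σ ^ x.1 : K ≃+* K) (cf q x.2) := by
  induction p using SkewPolynomial.induction with
  | h0 => simp
  | ha n r p _ _ hp =>
    rw [add_mul, cf_add, hp]
    simp only [cf_add, add_mul, Finset.sum_add_distrib]
    congr 1
    clear hp
    induction q using SkewPolynomial.induction with
    | h0 => simp
    | ha l s q _ _ hq =>
      rw [mul_add, cf_add, hq]
      simp only [cf_add, map_add, mul_add, Finset.sum_add_distrib]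
      congr 1
      obtain ⟨r, rfl⟩ := (TwistedField.of σ).surjective r
      obtain ⟨s, rfl⟩ := (TwistedField.of σ).surjective s
      rw [SkewPolynomial.monomial_mul_monomial, phi_iterate_of, ← map_mul, cf_monomial]
      simp only [cf_monomial]
      split_ifs with h
      · rw [Finset.sum_eq_single (n, l)]
        · simp
        · rintro ⟨i, j⟩ _ hij
          rcases eq_or_ne n i with rfl | hi
          · have : l ≠ j := fun h => hij (by rw [h])
            simp [this]
          · simp [hi]
        · simp [h]
      · symm
        refine Finset.sum_eq_zero ?_
        rintro ⟨i, j⟩ hx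
        rw [Finset.HasAntidiagonal.mem_antidiagonal] at hx
        simp only at hx ⊢
        split_ifs with h1 h2
        · omega
        all_goals simp

@[simp] theorem cf_const_mul (a : K) (p : SkewPoly σ) (i : ℕ) :
    cf (const σ a * p) i = a * cf p i := by
  rw [cf_mul, Finset.sum_eq_single (0, i)]
  · simp [const_eq_monomial, cf_monomial, -SkewPolynomial.monomial_zero_left]
  · rintro ⟨k, l⟩ h hne
    rw [Finset.HasAntidiagonal.mem_antidiagonal] at h
    have : 0 ≠ k := by rintro rfl; exact hne (by simp_all)
    simp [const_eq_monomial, cf_monomial, -SkewPolynomial.monomial_zero_left, this]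
  · simp

theorem cf_const (a : K) (i : ℕ) : cf (const σ a) i = if 0 = i then a else 0 := by
  rw [const_eq_monomial, cf_monomial]

theorem cf_t_pow (k i : ℕ) : cf (t σ ^ k) i = if k = i then 1 else 0 := by
  rw [← one_mul (t σ ^ k), ← map_one (const σ), const_mul_t_pow, cf_monomial]

theorem t_pow_mul_const (k : ℕ) (a : K) :
    t σ ^ k * const σ a = const σ ((σ ^ k : K ≃+* K) a) * t σ ^ k := by
  induction k with
  | zero => simp
  | succ k ih =>
    rw [pow_succ', mul_assoc, ih, ← mul_assoc, t_mul_const, mul_assoc, pow_succ' σ]; rfl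

/-- Every skew polynomial is a multiple of `t` on the right, up to its constant coefficient. -/
theorem exists_eq_mul_t_add_const (p : SkewPoly σ) :
    ∃ q : SkewPoly σ, p = q * t σ + const σ (cf p 0) := by
  induction p using SkewPolynomial.induction with
  | h0 => exact ⟨0, by simp⟩
  | ha n r p _ _ hp =>
    obtain ⟨q, hq⟩ := hp
    obtain ⟨r, rfl⟩ := (TwistedField.of σ).surjective r
    cases n with
    | zero =>
      refine ⟨q, ?_⟩
      rw [cf_add, cf_monomial, if_pos rfl, map_add, ← const_eq_monomial, add_left_comm, ← hq]
    | succ n =>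
      refine ⟨const σ r * t σ ^ n + q, ?_⟩
      rw [cf_add, cf_monomial, if_neg (by simp), zero_add, add_mul, add_assoc, ← hq,
        ← const_mul_t_pow, pow_succ, mul_assoc]

theorem sum_const_mul_t_pow (p : SkewPoly σ) {d : ℕ} (h : ∀ i, d ≤ i → cf p i = 0) :
    p = ∑ i ∈ Finset.range d, const σ (cf p i) * t σ ^ i := by
  refine (SkewPolynomial.sum_monomial p).symm.trans ?_
  rw [SkewPolynomial.sum_eq_of_subset (s := Finset.range d)]
  · exact Finset.sum_congr rfl fun i _ => by rw [const_mul_t_pow, of_cf]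
  · intro i; simp
  · intro i hi
    rw [SkewPolynomial.mem_support_iff] at hi
    rw [Finset.mem_range]
    by_contra hd
    exact hi (h i (not_lt.1 hd))

end Coefficients

/-! ### Degrees, units and right division -/

section Degree

variable {K : Type*} [Field K] {σ : K ≃+* K}

theorem mem_support {p : SkewPoly σ} {i : ℕ} : i ∈ SkewPolynomial.support p ↔ cf p i ≠ 0 :=
  SkewPolynomial.mem_support_iff

theorem natDegree_le_iff {p : SkewPoly σ} {d : ℕ} :
    natDegree p ≤ d ↔ ∀ i, d < i → cf p i = 0 := by
  rw [natDegree, Finset.sup_le_iff]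
  refine ⟨fun h i hi => ?_, fun h i hi => ?_⟩
  · by_contra hc
    exact absurd (h i (mem_support.2 hc)) (not_le.2 hi)
  · by_contra hc
    exact mem_support.1 hi (h i (not_le.1 hc))

theorem cf_eq_zero_of_natDegree_lt {p : SkewPoly σ} {i : ℕ} (h : natDegree p < i) : cf p i = 0 :=
  natDegree_le_iff.1 le_rfl i h

theorem le_natDegree {p : SkewPoly σ} {i : ℕ} (h : cf p i ≠ 0) : i ≤ natDegree p := by
  by_contra hc
  exact h (cf_eq_zero_of_natDegree_lt (not_le.1 hc))

theorem cf_natDegree_ne_zero {p : SkewPoly σ} (hp : p ≠ 0) : cf p (natDegree p) ≠ 0 := by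
  have hne : (SkewPolynomial.support p).Nonempty := by
    rw [Finset.nonempty_iff_ne_empty]
    exact fun h => hp (SkewPolynomial.support_eq_empty.1 h)
  obtain ⟨i, hi, h⟩ := Finset.exists_mem_eq_sup _ hne (id : ℕ → ℕ)
  rw [natDegree, h]
  exact mem_support.1 hi

theorem natDegree_eq {p : SkewPoly σ} {d : ℕ} (h0 : cf p d ≠ 0) (h : ∀ i, d < i → cf p i = 0) :
    natDegree p = d :=
  le_antisymm (natDegree_le_iff.2 h) (le_natDegree h0)

theorem isMonic_iff {p : SkewPoly σ} : IsMonic p ↔ cf p (natDegree p) = 1 := Iff.rfl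

theorem IsMonic.ne_zero {p : SkewPoly σ} (h : IsMonic p) : p ≠ 0 := by
  rintro rfl
  exact zero_ne_one (α := K) (isMonic_iff.1 h)

theorem cf_mul_add {p q : SkewPoly σ} {a b : ℕ} (hp : ∀ i, a < i → cf p i = 0)
    (hq : ∀ i, b < i → cf q i = 0) :
    cf (p * q) (a + b) = cf p a * (σ ^ a : K ≃+* K) (cf q b) := by
  rw [cf_mul, Finset.sum_eq_single (a, b)]
  · rintro ⟨i, j⟩ h hne
    rw [Finset.HasAntidiagonal.mem_antidiagonal] at h
    simp only at h ⊢
    rcases lt_trichotomy i a with hi | rfl | hi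
    · rw [hq j (by omega), map_zero, mul_zero]
    · exact absurd (by rw [Nat.add_left_cancel h]) hne
    · rw [hp i hi, zero_mul]
  · simp

theorem cf_mul_of_lt {p q : SkewPoly σ} {a b : ℕ} (hp : ∀ i, a < i → cf p i = 0)
    (hq : ∀ i, b < i → cf q i = 0) {k : ℕ} (hk : a + b < k) : cf (p * q) k = 0 := by
  rw [cf_mul]
  refine Finset.sum_eq_zero fun x hx => ?_
  rw [Finset.HasAntidiagonal.mem_antidiagonal] at hx
  rcases lt_or_ge a x.1 with h | h
  · rw [hp _ h, zero_mul]
  · rw [hq _ (by omega), map_zero, mul_zero]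

theorem cf_mul_natDegree (p q : SkewPoly σ) :
    cf (p * q) (natDegree p + natDegree q) =
      cf p (natDegree p) * (σ ^ natDegree p : K ≃+* K) (cf q (natDegree q)) :=
  cf_mul_add (fun _ => cf_eq_zero_of_natDegree_lt) (fun _ => cf_eq_zero_of_natDegree_lt)

theorem cf_mul_natDegree_ne_zero {p q : SkewPoly σ} (hp : p ≠ 0) (hq : q ≠ 0) :
    cf (p * q) (natDegree p + natDegree q) ≠ 0 := by
  rw [cf_mul_natDegree]
  exact mul_ne_zero (cf_natDegree_ne_zero hp)
    ((map_ne_zero_iff _ (RingEquiv.injective _)).2 (cf_natDegree_ne_zero hq))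

theorem natDegree_mul {p q : SkewPoly σ} (hp : p ≠ 0) (hq : q ≠ 0) :
    natDegree (p * q) = natDegree p + natDegree q :=
  natDegree_eq (cf_mul_natDegree_ne_zero hp hq) fun _ =>
    cf_mul_of_lt (fun _ => cf_eq_zero_of_natDegree_lt) (fun _ => cf_eq_zero_of_natDegree_lt)

instance : NoZeroDivisors (SkewPoly σ) where
  eq_zero_or_eq_zero_of_mul_eq_zero {p q} h := by
    by_contra! hc
    exact cf_mul_natDegree_ne_zero hc.1 hc.2 (by rw [h, cf_zero])

theorem eq_const_of_natDegree_eq_zero {p : SkewPoly σ} (h : natDegree p = 0) :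
    p = const σ (cf p 0) := by
  refine ext_cf fun i => ?_
  rw [cf_const]
  split_ifs with hi
  · rw [hi]
  · exact cf_eq_zero_of_natDegree_lt (by omega)

theorem natDegree_const (a : K) : natDegree (const σ a) = 0 :=
  Nat.le_zero.1 (natDegree_le_iff.2 fun i hi => by rw [cf_const, if_neg hi.ne])

theorem isUnit_const {a : K} (ha : a ≠ 0) : IsUnit (const σ a) :=
  (IsUnit.mk0 a ha).map (const σ)

theorem isUnit_iff_natDegree_eq_zero {p : SkewPoly σ} (hp : p ≠ 0) :
    IsUnit p ↔ natDegree p = 0 := by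
  refine ⟨fun h => ?_, fun h => ?_⟩
  · obtain ⟨q, hq⟩ := h.exists_right_inv
    have hq0 : q ≠ 0 := by rintro rfl; simp at hq
    have := natDegree_mul hp hq0
    rw [hq, ← map_one (const σ), natDegree_const] at this
    omega
  · rw [eq_const_of_natDegree_eq_zero h] at hp ⊢
    exact isUnit_const fun h0 => hp (by rw [h0, map_zero])

theorem natDegree_lt_of_cf {p : SkewPoly σ} {d : ℕ} (hd : 0 < d) (h : ∀ i, d ≤ i → cf p i = 0) :
    natDegree p < d := by
  have : natDegree p ≤ d - 1 := natDegree_le_iff.2 fun i hi => h i (by omega)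
  omega

/-- Right division with remainder. -/
theorem exists_sub_mul {f : SkewPoly σ} (hf : f ≠ 0) (p : SkewPoly σ) :
    ∃ q : SkewPoly σ, ∀ i, natDegree f ≤ i → cf (p - q * f) i = 0 := by
  suffices H : ∀ (N : ℕ) (p : SkewPoly σ), (∀ i, N ≤ i → cf p i = 0) →
      ∃ q : SkewPoly σ, ∀ i, natDegree f ≤ i → cf (p - q * f) i = 0 from
    H (natDegree p + 1) p fun i hi => cf_eq_zero_of_natDegree_lt (by omega)
  intro N
  induction N with
  | zero => exact fun p hp => ⟨0, fun i _ => by simpa using hp i (Nat.zero_le _)⟩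
  | succ N ih =>
    intro p hp
    rcases lt_or_ge N (natDegree f) with h | h
    · exact ⟨0, fun i hi => by simpa using hp i (by omega)⟩
    · obtain ⟨k, rfl⟩ := Nat.exists_eq_add_of_le' h
      have hc : (σ ^ k : K ≃+* K) (cf f (natDegree f)) ≠ 0 :=
        (map_ne_zero_iff _ (RingEquiv.injective _)).2 (cf_natDegree_ne_zero hf)
      -- The multiplier c t^k is chosen so that c t^k f cancels the coefficient of p in degree k +
      -- deg f; moving past t^k twists the leading coefficient of f by σ^k.
      set c : K := cf p (k + natDegree f) / (σ ^ k : K ≃+* K) (cf f (natDegree f)) with hcdef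
      have hk : ∀ i, k < i → cf (t σ ^ k) i = 0 := fun i hi => by rw [cf_t_pow, if_neg hi.ne]
      obtain ⟨q, hq⟩ := ih (p - const σ c * (t σ ^ k * f)) (fun i hi => by
        rw [cf_sub, cf_const_mul]
        rcases hi.eq_or_lt with rfl | hi
        · rw [cf_mul_add hk fun _ => cf_eq_zero_of_natDegree_lt, cf_t_pow, if_pos rfl, one_mul,
            hcdef, div_mul_cancel₀ _ hc, sub_self]
        · rw [hp i hi, cf_mul_of_lt hk (fun _ => cf_eq_zero_of_natDegree_lt) hi, mul_zero,
            sub_zero])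
      refine ⟨q + const σ c * t σ ^ k, fun i hi => ?_⟩
      rw [← hq i hi, add_mul, mul_assoc, sub_sub, add_comm (q * f)]

/-- Degrees add, so nonzero left multiples of f have degree at least deg f. This is uniqueness of
remainders, used to turn congruences mod Rf into identities of coefficients. -/
theorem eq_zero_of_mem_span {f p : SkewPoly σ} (hp : p ∈ Ideal.span {f})
    (h : ∀ i, natDegree f ≤ i → cf p i = 0) : p = 0 := by
  obtain ⟨q, rfl⟩ := Ideal.mem_span_singleton'.1 hp
  by_contra hne
  exact cf_mul_natDegree_ne_zero (left_ne_zero_of_mul hne) (right_ne_zero_of_mul hne)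
    (h _ (Nat.le_add_left _ _))

end Degree

/-! ### R/Rf as a K-space of dimension deg f -/

section LeftModule

variable {K : Type*} [Field K] {σ : K ≃+* K}

/-- Left multiplication by constants. -/
instance instModuleBase : Module K (SkewPoly σ) := Module.compHom _ (const σ)

theorem smul_eq_const_mul (a : K) (p : SkewPoly σ) : a • p = const σ a * p := rfl

instance instIsScalarTowerBase : IsScalarTower K (SkewPoly σ) (SkewPoly σ) where
  smul_assoc a p q := mul_assoc (const σ a) p q

/-- The coefficient of `t ^ i`, as a `K`-linear map. -/
def lcf (i : ℕ) : SkewPoly σ →ₗ[K] K where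
  toFun p := cf p i
  map_add' p q := cf_add p q i
  map_smul' a p := cf_const_mul a p i

/-- The class of a skew polynomial with given coefficients in degrees below `natDegree f`. -/
def quotientEquiv {f : SkewPoly σ} (hf : f ≠ 0) :
    (Fin (natDegree f) → K) ≃ₗ[K] SkewPoly σ ⧸ Ideal.span {f} :=
  LinearEquiv.ofBijective
    (((Ideal.span {f}).mkQ.restrictScalars K).comp
      (Fintype.linearCombination K fun i : Fin (natDegree f) => t σ ^ (i : ℕ))) <| by
    have hcf : ∀ (c : Fin (natDegree f) → K) (i : ℕ),
        cf (Fintype.linearCombination K (fun i : Fin (natDegree f) => t σ ^ (i : ℕ)) c) i =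
          if h : i < natDegree f then c ⟨i, h⟩ else 0 := by
      intro c i
      rw [Fintype.linearCombination_apply]
      change lcf i _ = _
      rw [map_sum]
      change ∑ j, cf (const σ (c j) * t σ ^ (j : ℕ)) i = _
      simp only [cf_const_mul, cf_t_pow, mul_ite, mul_one, mul_zero]
      split_ifs with h
      · rw [Finset.sum_eq_single (⟨i, h⟩ : Fin (natDegree f))]
        · simp
        · intro j _ hj
          rw [if_neg fun h => hj (Fin.ext h)]
        · simp
      · refine Finset.sum_eq_zero fun j _ => if_neg fun hj : (j : ℕ) = i => h (hj ▸ j.2)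
    constructor
    · rw [← LinearMap.ker_eq_bot, LinearMap.ker_eq_bot']
      intro c hc
      have hmem : Fintype.linearCombination K (fun i : Fin (natDegree f) => t σ ^ (i : ℕ)) c ∈
          Ideal.span {f} := (Submodule.Quotient.mk_eq_zero _).1 hc
      have h0 := eq_zero_of_mem_span hmem fun i hi => by rw [hcf, dif_neg (not_lt.2 hi)]
      funext i
      have := hcf c i
      rw [h0, dif_pos i.2] at this
      exact this.symm
    · intro v
      obtain ⟨p, rfl⟩ := Submodule.Quotient.mk_surjective _ v
      obtain ⟨q, hq⟩ := exists_sub_mul hf p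
      refine ⟨fun i => cf (p - q * f) i, ?_⟩
      refine (Submodule.Quotient.eq _).2 ?_
      have : Fintype.linearCombination K (fun i : Fin (natDegree f) => t σ ^ (i : ℕ))
          (fun i => cf (p - q * f) i) = p - q * f := ext_cf fun i => by
        rw [hcf]
        split_ifs with h
        · rfl
        · exact (hq i (not_lt.1 h)).symm
      change _ - p ∈ _
      rw [this, sub_sub_cancel_left]
      exact neg_mem (Ideal.mul_mem_left _ _ (Ideal.mem_span_singleton_self f))

theorem finite_quotient {f : SkewPoly σ} (hf : f ≠ 0) :
    Module.Finite K (SkewPoly σ ⧸ Ideal.span {f}) :=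
  Module.Finite.equiv (quotientEquiv hf)

theorem finrank_quotient {f : SkewPoly σ} (hf : f ≠ 0) :
    Module.finrank K (SkewPoly σ ⧸ Ideal.span {f}) = natDegree f := by
  rw [← (quotientEquiv hf).finrank_eq, Module.finrank_fin_fun]

end LeftModule

end SkewPoly

/-! ### Semilinear maps: determinants and Galois descent -/

section Semilinear

variable {K V : Type*} [Field K] [AddCommGroup V] [Module K V] {σ : K ≃+* K}

theorem iterate_smul {T : V →+ V} (hT : ∀ (a : K) (v : V), T (a • v) = σ a • T v) (k : ℕ) (a : K)
    (v : V) : T^[k] (a • v) = (σ ^ k : K ≃+* K) a • T^[k] v := by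
  induction k with
  | zero => simp
  | succ k ih => rw [Function.iterate_succ_apply', ih, hT, Function.iterate_succ_apply', pow_succ']
                 rfl

/-- If the `n`-th power of a semilinear map is a fixed scalar `a`, then `a` is a norm as soon as
the dimension is coprime to `n`: take determinants. -/
theorem exists_prod_eq_of_coprime_finrank [Module.Finite K V] {T : V →+ V}
    (hT : ∀ (a : K) (v : V), T (a • v) = σ a • T v) {n : ℕ} {a : K} (ha : a ≠ 0) (haσ : σ a = a)
    (hTn : ∀ v, T^[n] v = a • v) (hcop : Nat.Coprime (Module.finrank K V) n) :
    ∃ b : K, ∏ i ∈ Finset.range n, (σ ^ i : K ≃+* K) b = a := by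
  let e := Module.finBasis K V
  let B : ℕ → Matrix _ _ K := fun k => Matrix.of fun i j => e.repr (T^[k] (e j)) i
  -- B k is the matrix of T^k; composing with T on the left twists the entries of B k by σ.
  have hB : ∀ k, B (k + 1) = B 1 * (B k).map σ := by
    intro k
    ext i j
    have h : T^[k + 1] (e j) = ∑ l, σ (B k l j) • T (e l) := by
      rw [Function.iterate_succ_apply', ← e.sum_repr (T^[k] (e j)), map_sum]
      exact Finset.sum_congr rfl fun l _ => hT _ _
    change e.repr (T^[k + 1] (e j)) i = _
    rw [h, map_sum, Finsupp.finsetSum_apply, Matrix.mul_apply]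
    refine Finset.sum_congr rfl fun l _ => ?_
    rw [map_smul, Finsupp.smul_apply, smul_eq_mul, mul_comm]
    rfl
  have hdet : ∀ k, (B k).det = ∏ i ∈ Finset.range k, (σ ^ i : K ≃+* K) (B 1).det := by
    intro k
    induction k with
    | zero =>
      have : B 0 = 1 := by
        ext i j
        change e.repr (e j) i = _
        rw [e.repr_self, Matrix.one_apply, Finsupp.single_apply]
        simp only [eq_comm]
      rw [this, Matrix.det_one, Finset.prod_range_zero]
    | succ k ih =>
      have hσdet : ((B k).map σ).det = σ (B k).det := ((σ : K →+* K).map_det (B k)).symm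
      rw [hB, Matrix.det_mul, hσdet, ih, Finset.prod_range_succ', map_prod, mul_comm]
      congr 1
      exact Finset.prod_congr rfl fun i _ => by rw [pow_succ']; rfl
  have hn : B n = a • (1 : Matrix _ _ K) := by
    ext i j
    change e.repr (T^[n] (e j)) i = _
    rw [hTn, map_smul, e.repr_self, Finsupp.smul_apply, Matrix.smul_apply, Matrix.one_apply,
      Finsupp.single_apply]
    simp only [eq_comm]
  have hβ := hdet n
  rw [hn, Matrix.det_smul, Matrix.det_one, mul_one, Fintype.card_fin] at hβ
  have hσa : ∀ i : ℕ, (σ ^ i : K ≃+* K) a = a := by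
    intro i
    induction i with
    | zero => rfl
    | succ i ih => rw [pow_succ']; exact (congrArg σ ih).trans haσ
  -- Now N(det B 1) = a^d with d the dimension, while N(a) = a^n because σ fixes a. With du + nv =
  -- 1, the element (det B 1)^u a^v has norm a.
  have hbez : (Module.finrank K V : ℤ) * Nat.gcdA (Module.finrank K V) n +
      n * Nat.gcdB (Module.finrank K V) n = 1 := by
    rw [← Nat.gcd_eq_gcd_ab, hcop.gcd_eq_one, Nat.cast_one]
  refine ⟨(B 1).det ^ Nat.gcdA (Module.finrank K V) n * a ^ Nat.gcdB (Module.finrank K V) n, ?_⟩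
  simp only [map_mul, map_zpow₀, hσa, Finset.prod_mul_distrib, Finset.prod_zpow, ← hβ,
    Finset.prod_const, Finset.card_range]
  rw [← zpow_natCast, ← zpow_natCast, ← zpow_mul, ← zpow_mul, ← zpow_add₀ ha, hbez, zpow_one]

/-- Descent: if `T ^ n` is the scalar `N(b)`, then the eigenvectors of `T` for `b` span. -/
theorem span_eigenvectors_eq_top {T : V →+ V} (hT : ∀ (a : K) (v : V), T (a • v) = σ a • T v)
    {n : ℕ} (hσ : orderOf σ = n) (hn : 0 < n) {b : K} (hb : b ≠ 0)
    (hTn : ∀ v, T^[n] v = (∏ i ∈ Finset.range n, (σ ^ i : K ≃+* K) b) • v) :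
    Submodule.span K {w : V | T w = b • w} = ⊤ := by
  -- The normalisation S = b⁻¹T is σ-semilinear with S^n = 1, and its fixed vectors are the
  -- b-eigenvectors of T.
  let S : V →+ V := (DistribSMul.toAddMonoidHom V b⁻¹).comp T
  have hS : ∀ v, S v = b⁻¹ • T v := fun _ => rfl
  have hSsmul : ∀ (a : K) (v : V), S (a • v) = σ a • S v := fun a v => by
    rw [hS, hS, hT, smul_comm]
  have hSk : ∀ k v, S^[k] v = (∏ i ∈ Finset.range k, (σ ^ i : K ≃+* K) b)⁻¹ • T^[k] v := by
    intro k v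
    induction k with
    | zero => simp
    | succ k ih =>
      rw [Function.iterate_succ_apply', ih, hSsmul, hS, ← Function.iterate_succ_apply' T, smul_smul,
        map_inv₀, map_prod, Finset.prod_range_succ', mul_inv]
      simp only [pow_succ']
      rfl
  have hN : ∏ i ∈ Finset.range n, (σ ^ i : K ≃+* K) b ≠ 0 :=
    Finset.prod_ne_zero_iff.2 fun i _ => (map_ne_zero_iff _ (RingEquiv.injective _)).2 hb
  have hSn : ∀ v, S^[n] v = v := fun v => by rw [hSk, hTn, smul_smul, inv_mul_cancel₀ hN, one_smul]
  rw [eq_top_iff]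
  intro v _
  by_contra hv
  -- A functional φ kills the eigenvectors but not v. For every c the trace ∑ S^i(c v) is S-fixed,
  -- so ∑ σ^i(c) φ(S^i v) = 0; independence of the distinct characters σ^i forces every φ(S^i v) to
  -- vanish, and i = 0 contradicts φ(v) ≠ 0.
  obtain ⟨φ, hφv, hφ⟩ := Submodule.exists_le_ker_of_notMem hv
  have hinj : Function.Injective fun i : Fin n => ((σ ^ (i : ℕ) : K ≃+* K) : K →* K) := by
    intro i j hij
    have h : σ ^ (i : ℕ) = σ ^ (j : ℕ) := RingEquiv.ext fun x => DFunLike.congr_fun hij x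
    exact Fin.ext (pow_injOn_Iio_orderOf (by simp [hσ]) (by simp [hσ]) h)
  have hli := (linearIndependent_monoidHom K K).comp _ hinj
  rw [Fintype.linearIndependent_iff] at hli
  have h0 := hli (fun i => φ (S^[(i : ℕ)] v)) (by
    funext c
    rw [Finset.sum_apply, Pi.zero_apply]
    have hw : ∑ i ∈ Finset.range n, S^[i] (c • v) ∈ {w : V | T w = b • w} := by
      have hfix : S (∑ i ∈ Finset.range n, S^[i] (c • v)) =
          ∑ i ∈ Finset.range n, S^[i] (c • v) := by
        rw [map_sum]
        simp only [← Function.iterate_succ_apply' S]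
        have h1 := Finset.sum_range_succ (fun i => S^[i] (c • v)) n
        rw [Finset.sum_range_succ', hSn, Function.iterate_zero_apply] at h1
        exact add_right_cancel h1
      change T _ = b • _
      conv_rhs => rw [← hfix, hS, smul_smul, mul_inv_cancel₀ hb, one_smul]
    have := hφ (Submodule.subset_span hw)
    rw [LinearMap.mem_ker, map_sum, ← Fin.sum_univ_eq_sum_range (fun i => φ (S^[i] (c • v)))] at this
    rw [← this]
    refine Finset.sum_congr rfl fun i _ => ?_
    rw [iterate_smul hSsmul, map_smul, smul_eq_mul, Pi.smul_apply, smul_eq_mul, mul_comm]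
    rfl) ⟨0, hn⟩
  exact hφv h0

end Semilinear

/-! ### The norm of K/F as a product of conjugates -/

namespace SkewPoly

variable {K : Type*} [Field K] {σ : K ≃+* K}

/-- Artin's theorem then makes K/F finite Galois with group generated by σ, which identifies the
field norm with the product over powers of σ. -/
theorem isGaloisGroup_zpowers (σ : K ≃+* K) :
    IsGaloisGroup (Subgroup.zpowers (σ : RingAut K)) (fixedField σ) K where
  faithful := ⟨fun {g h} H => Subtype.ext (RingEquiv.ext H)⟩
  commutes := by
    constructor
    rintro ⟨g, hg⟩ a x
    have hga : g (a : K) = a := by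
      have hle : Subgroup.zpowers (σ : RingAut K) ≤ MulAction.stabilizer (RingAut K) (a : K) :=
        (Subgroup.zpowers_le).2 a.2
      exact hle hg
    change g ((a : K) * x) = (a : K) * g x
    rw [map_mul, hga]
  isInvariant := ⟨fun b hb => ⟨⟨b, hb ⟨σ, Subgroup.mem_zpowers σ⟩⟩, rfl⟩⟩

theorem coe_norm_eq_prod {n : ℕ} (hσ : orderOf σ = n) (hn : 0 < n) (b : K) :
    ((Algebra.norm (fixedField σ) b : fixedField σ) : K) =
      ∏ i ∈ Finset.range n, (σ ^ i : K ≃+* K) b := by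
  subst hσ
  have hfin : IsOfFinOrder (σ : RingAut K) := orderOf_pos_iff.1 hn
  have : Finite (Subgroup.zpowers (σ : RingAut K)) := hfin.finite_zpowers
  have hG := isGaloisGroup_zpowers σ
  have := IsGaloisGroup.isGalois (Subgroup.zpowers (σ : RingAut K)) (fixedField σ) K
  have := IsGaloisGroup.finiteDimensional (Subgroup.zpowers (σ : RingAut K)) (fixedField σ) K
  have h := Algebra.norm_eq_prod_automorphisms (fixedField σ) b
  refine h.trans ?_
  rw [← Fin.prod_univ_eq_prod_range (fun i => (σ ^ i : K ≃+* K) b)]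
  symm
  exact Fintype.prod_equiv ((finEquivZPowers hfin).trans
    (IsGaloisGroup.mulEquivAlgEquiv (Subgroup.zpowers (σ : RingAut K)) (fixedField σ) K).toEquiv)
    _ _ fun i => rfl

theorem finite_fixedField {n : ℕ} (hσ : orderOf σ = n) (hn : 0 < n) :
    Module.Finite (fixedField σ) K := by
  subst hσ
  have hfin : IsOfFinOrder (σ : RingAut K) := orderOf_pos_iff.1 hn
  have : Finite (Subgroup.zpowers (σ : RingAut K)) := hfin.finite_zpowers
  have hG := isGaloisGroup_zpowers σ
  exact IsGaloisGroup.finiteDimensional (Subgroup.zpowers (σ : RingAut K)) (fixedField σ) K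

end SkewPoly

namespace SkewPoly

/-! ### R-modules with a basis of eigenvectors of t -/

section Action

variable {K V : Type*} [Field K] {σ : K ≃+* K} [AddCommGroup V] [Module (SkewPoly σ) V]
  [Module K V] [IsScalarTower K (SkewPoly σ) V]

theorem const_smul (a : K) (v : V) : const σ a • v = a • v := by
  rw [← mul_one (const σ a), ← smul_eq_const_mul, smul_assoc, one_smul]

variable (σ) in
theorem t_smul_smul (a : K) (v : V) : t σ • a • v = σ a • t σ • v := by
  rw [← const_smul (σ := σ), ← mul_smul, t_mul_const, mul_smul, const_smul]

/-- A `K`-linear map that commutes with `t` is linear over `K[t;σ]`. -/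
def linearMapOfCommutes (φ : V →ₗ[K] V) (h : ∀ v, φ (t σ • v) = t σ • φ v) :
    V →ₗ[SkewPoly σ] V where
  toFun := φ
  map_add' := φ.map_add
  map_smul' p v := by
    have hpow : ∀ (k : ℕ) (v : V), φ (t σ ^ k • v) = t σ ^ k • φ v := by
      intro k
      induction k with
      | zero => simp
      | succ k ih => intro v; rw [pow_succ', mul_smul, h, ih, mul_smul]
    rw [RingHom.id_apply]
    induction p using SkewPolynomial.induction with
    | h0 => simp
    | ha k r p _ _ hp =>
      obtain ⟨r, rfl⟩ := (TwistedField.of σ).surjective r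
      rw [add_smul, map_add, hp, add_smul, ← const_mul_t_pow, mul_smul, const_smul, map_smul, hpow,
        mul_smul, const_smul]

variable {ι : Type*} [Fintype ι] {b : K}

theorem repr_t_smul (e : Module.Basis ι K V) (he : ∀ j, t σ • e j = b • e j) (v : V) (k : ι) :
    e.repr (t σ • v) k = σ (e.repr v k) * b := by
  classical
  conv_lhs => rw [← e.sum_repr v]
  simp only [Finset.smul_sum, t_smul_smul σ, he, map_sum, map_smul, e.repr_self,
    Finsupp.finsetSum_apply, Finsupp.smul_apply, Finsupp.single_apply, smul_eq_mul]
  rw [Finset.sum_eq_single k]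
  · simp
  · intro j _ hj
    simp [hj]
  · simp

/-- An R-endomorphism sends a b-eigenvector to a b-eigenvector, and a coordinate x of such a vector
satisfies σ(x) b = b x. -/
theorem repr_apply_mem_fixedField (hb : b ≠ 0) (e : Module.Basis ι K V)
    (he : ∀ j, t σ • e j = b • e j) (φ : V →ₗ[SkewPoly σ] V) (j k : ι) :
    e.repr (φ (e j)) k ∈ fixedField σ := by
  have h : t σ • φ (e j) = b • φ (e j) := by
    rw [← φ.map_smul, he, ← const_smul (σ := σ), φ.map_smul, const_smul]
  have h2 := repr_t_smul e he (φ (e j)) k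
  rw [h, map_smul, Finsupp.smul_apply, smul_eq_mul, mul_comm] at h2
  exact (mul_right_cancel₀ hb h2).symm

/-- The endomorphism with a given matrix over `F` in a basis of eigenvectors of `t`. -/
theorem exists_linearMap_of_matrix (e : Module.Basis ι K V) (he : ∀ j, t σ • e j = b • e j)
    (M : Matrix ι ι (fixedField σ)) :
    ∃ φ : V →ₗ[SkewPoly σ] V, ∀ j k, e.repr (φ (e j)) k = M j k := by
  classical
  let φ : V →ₗ[K] V := e.constr K fun j => ∑ k, (M j k : K) • e k
  have hφ : ∀ j, φ (e j) = ∑ k, (M j k : K) • e k := fun j => e.constr_basis K _ j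
  have hM : ∀ j k, σ (M j k : K) = M j k := fun j k => (M j k).2
  refine ⟨linearMapOfCommutes φ fun v => ?_, fun j k => ?_⟩
  · rw [← e.sum_repr v]
    simp only [Finset.smul_sum, map_sum, t_smul_smul σ, he, map_smul, hφ, hM]
    refine Finset.sum_congr rfl fun j _ => Finset.sum_congr rfl fun k _ => ?_
    rw [smul_comm b]
  · change e.repr (φ (e j)) k = _
    rw [hφ]
    simp only [map_sum, map_smul, e.repr_self, Finsupp.finsetSum_apply, Finsupp.smul_apply,
      Finsupp.single_apply, smul_eq_mul]
    rw [Finset.sum_eq_single k]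
    · simp
    · intro l _ hl
      simp [hl]
    · simp

end Action

/-! ### The central elements t^n - a and their quotients -/

section Central

variable {K : Type*} [Field K] {σ : K ≃+* K} {n : ℕ}

theorem t_pow_mul_comm (hσ : orderOf σ = n) (p : SkewPoly σ) : t σ ^ n * p = p * t σ ^ n := by
  have h1 : σ ^ n = 1 := hσ ▸ pow_orderOf_eq_one σ
  induction p using SkewPolynomial.induction with
  | h0 => simp
  | ha k r p _ _ hp =>
    obtain ⟨r, rfl⟩ := (TwistedField.of σ).surjective r
    rw [mul_add, add_mul, hp, ← const_mul_t_pow, ← mul_assoc, t_pow_mul_const, h1, mul_assoc,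
      ← pow_add, add_comm n k, pow_add, ← mul_assoc]
    rfl

theorem t_pow_sub_const_mul_comm (hσ : orderOf σ = n) {a : K} (ha : σ a = a) (p : SkewPoly σ) :
    (t σ ^ n - const σ a) * p = p * (t σ ^ n - const σ a) := by
  rw [sub_mul, mul_sub, t_pow_mul_comm hσ, const_fixed_commutes σ ⟨a, ha⟩ p]

theorem natDegree_t_pow_sub_const (hn : 0 < n) (a : K) :
    natDegree (t σ ^ n - const σ a) = n := by
  refine natDegree_eq ?_ fun i hi => ?_
  · rw [cf_sub, cf_t_pow, if_pos rfl, cf_const, if_neg hn.ne, sub_zero]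
    exact one_ne_zero
  · rw [cf_sub, cf_t_pow, if_neg hi.ne, cf_const, if_neg (by omega), sub_zero]

theorem isMonic_t_pow_sub_const (hn : 0 < n) (a : K) : IsMonic (t σ ^ n - const σ a) := by
  rw [isMonic_iff, natDegree_t_pow_sub_const hn, cf_sub, cf_t_pow, if_pos rfl, cf_const,
    if_neg hn.ne, sub_zero]

theorem iterate_t_smul {V : Type*} [AddCommGroup V] [Module (SkewPoly σ) V] (k : ℕ) (v : V) :
    (DistribSMul.toAddMonoidHom V (t σ))^[k] v = t σ ^ k • v := by
  induction k with
  | zero => simp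
  | succ k ih => rw [Function.iterate_succ_apply', ih, pow_succ', mul_smul]; rfl

/-- Centrality of t^n - a moves it to the right of any representative, so membership in the left
ideal suffices. Allowing a general I matters for the simplicity proof. -/
theorem t_pow_smul_quotient (hσ : orderOf σ = n) {a : K} (ha : σ a = a)
    {I : Ideal (SkewPoly σ)} (h : t σ ^ n - const σ a ∈ I) (v : SkewPoly σ ⧸ I) :
    t σ ^ n • v = a • v := by
  obtain ⟨p, rfl⟩ := Submodule.Quotient.mk_surjective _ v
  refine (Submodule.Quotient.eq _).2 ?_
  change t σ ^ n * p - const σ a * p ∈ I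
  rw [← sub_mul, t_pow_sub_const_mul_comm hσ ha]
  exact Ideal.mul_mem_left _ _ h

theorem exists_prod_eq_of_coprime_finrank_quotient (hσ : orderOf σ = n) {a : K} (ha0 : a ≠ 0)
    (ha : σ a = a) {I : Ideal (SkewPoly σ)} [Module.Finite K (SkewPoly σ ⧸ I)]
    (h : t σ ^ n - const σ a ∈ I) (hcop : (Module.finrank K (SkewPoly σ ⧸ I)).Coprime n) :
    ∃ b : K, ∏ i ∈ Finset.range n, (σ ^ i : K ≃+* K) b = a :=
  exists_prod_eq_of_coprime_finrank (T := DistribSMul.toAddMonoidHom (SkewPoly σ ⧸ I) (t σ))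
    (t_smul_smul σ) ha0 ha
    (fun v => by rw [iterate_t_smul, t_pow_smul_quotient hσ ha h]) hcop

/-- Applying σ permutes the factors cyclically, since σ^n = 1. -/
theorem map_prod_range_orderOf (hσ : orderOf σ = n) (b : K) :
    σ (∏ i ∈ Finset.range n, (σ ^ i : K ≃+* K) b) = ∏ i ∈ Finset.range n, (σ ^ i : K ≃+* K) b := by
  rcases eq_or_ne b 0 with rfl | hb
  · simp
  have h1 : σ ^ n = 1 := hσ ▸ pow_orderOf_eq_one σ
  have h := Finset.prod_range_succ (fun i => (σ ^ i : K ≃+* K) b) n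
  rw [Finset.prod_range_succ', h1] at h
  rw [map_prod]
  refine Eq.trans ?_ (mul_right_cancel₀ hb h)
  exact Finset.prod_congr rfl fun i _ => by rw [pow_succ']; rfl

theorem span_eigenvectors_quotient (hσ : orderOf σ = n) (hn : 0 < n) {b : K} (hb : b ≠ 0)
    {I : Ideal (SkewPoly σ)}
    (h : t σ ^ n - const σ (∏ i ∈ Finset.range n, (σ ^ i : K ≃+* K) b) ∈ I) :
    Submodule.span K {w : SkewPoly σ ⧸ I | t σ • w = b • w} = ⊤ :=
  span_eigenvectors_eq_top (T := DistribSMul.toAddMonoidHom (SkewPoly σ ⧸ I) (t σ))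
    (t_smul_smul σ) hσ hn hb fun v => by
      rw [iterate_t_smul, t_pow_smul_quotient hσ (map_prod_range_orderOf hσ b) h]

end Central

/-! ### The eigenring as endomorphisms of R/Rf -/

section Eigenring

variable {K : Type*} [Field K] {σ : K ≃+* K} {n : ℕ} {f : SkewPoly σ}

/-- Right multiplication by an element of the idealiser, on `R ⧸ R f`. -/
def rightMul (g : idealiser (fixedField σ) f) :
    (SkewPoly σ ⧸ Ideal.span {f}) →ₗ[SkewPoly σ] (SkewPoly σ ⧸ Ideal.span {f}) :=
  Submodule.liftQ _ (LinearMap.toSpanSingleton (SkewPoly σ) _ (Submodule.Quotient.mk (g : SkewPoly σ)))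
    ((Ideal.span_singleton_le_iff_mem _).2 ((Submodule.Quotient.mk_eq_zero _).2 g.2))

theorem rightMul_mk (g : idealiser (fixedField σ) f) (p : SkewPoly σ) :
    rightMul g (Submodule.Quotient.mk p) = Submodule.Quotient.mk (p * (g : SkewPoly σ)) := rfl

/-- The module is cyclic, so φ is determined by a lift g of the image of 1; since f kills the class
of 1, f g lies in Rf. -/
theorem exists_eq_rightMul
    (φ : (SkewPoly σ ⧸ Ideal.span {f}) →ₗ[SkewPoly σ] (SkewPoly σ ⧸ Ideal.span {f})) :
    ∃ g : idealiser (fixedField σ) f, rightMul g = φ := by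
  obtain ⟨g, hg⟩ := Submodule.Quotient.mk_surjective _ (φ (Submodule.Quotient.mk 1))
  have hmul : ∀ p : SkewPoly σ, Submodule.Quotient.mk (p * g) = φ (Submodule.Quotient.mk p) := by
    intro p
    rw [← smul_eq_mul, Submodule.Quotient.mk_smul, hg, ← φ.map_smul, ← Submodule.Quotient.mk_smul,
      smul_eq_mul, mul_one]
  refine ⟨⟨g, ?_⟩, ?_⟩
  · refine (Submodule.Quotient.mk_eq_zero _).1 ((hmul f).trans ?_)
    rw [(Submodule.Quotient.mk_eq_zero _).2 (Ideal.mem_span_singleton_self f), map_zero]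
  · refine LinearMap.ext fun v => ?_
    obtain ⟨p, rfl⟩ := Submodule.Quotient.mk_surjective _ v
    exact hmul p

variable {ι : Type*} [Fintype ι] [DecidableEq ι] {b : K}

/-- The matrix of right multiplication in a basis of eigenvectors of `t`. -/
def toMatrixHom (hb : b ≠ 0) (e : Module.Basis ι K (SkewPoly σ ⧸ Ideal.span {f}))
    (he : ∀ j, t σ • e j = b • e j) :
    idealiser (fixedField σ) f →ₐ[fixedField σ] Matrix ι ι (fixedField σ) where
  -- Images of basis vectors are stored as rows: right multiplication reverses composition, and this
  -- transposition makes the map multiplicative rather than antimultiplicative.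
  toFun g := Matrix.of fun j k =>
    ⟨e.repr (rightMul g (e j)) k, repr_apply_mem_fixedField hb e he _ j k⟩
  map_one' := by
    ext j k
    have h : rightMul (1 : idealiser (fixedField σ) f) (e j) = e j := by
      obtain ⟨p, hp⟩ := Submodule.Quotient.mk_surjective _ (e j)
      rw [← hp, rightMul_mk, OneMemClass.coe_one, mul_one]
    simp only [Matrix.of_apply, h, e.repr_self, Matrix.one_apply, Finsupp.single_apply]
    split_ifs <;> rfl
  map_mul' g g' := by
    ext j k
    have h : rightMul (g * g') (e j) = rightMul g' (rightMul g (e j)) := by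
      obtain ⟨p, hp⟩ := Submodule.Quotient.mk_surjective _ (e j)
      rw [← hp, rightMul_mk, rightMul_mk, rightMul_mk, MulMemClass.coe_mul, mul_assoc]
    have h2 : rightMul g' (rightMul g (e j)) =
        ∑ l, e.repr (rightMul g (e j)) l • rightMul g' (e l) := by
      conv_lhs => rw [← e.sum_repr (rightMul g (e j))]
      rw [map_sum]
      exact Finset.sum_congr rfl fun l _ => by
        rw [← const_smul (σ := σ), (rightMul g').map_smul, const_smul]
    simp only [Matrix.of_apply, h, Matrix.mul_apply, h2, map_sum, map_smul, Finsupp.finsetSum_apply,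
      Finsupp.smul_apply, smul_eq_mul, AddSubmonoidClass.coe_finsetSum, MulMemClass.coe_mul]
  map_zero' := by
    ext j k
    have h : rightMul (0 : idealiser (fixedField σ) f) (e j) = 0 := by
      obtain ⟨p, hp⟩ := Submodule.Quotient.mk_surjective _ (e j)
      rw [← hp, rightMul_mk, ZeroMemClass.coe_zero, mul_zero, Submodule.Quotient.mk_zero]
    simp [h]
  map_add' g g' := by
    ext j k
    have h : rightMul (g + g') (e j) = rightMul g (e j) + rightMul g' (e j) := by
      obtain ⟨p, hp⟩ := Submodule.Quotient.mk_surjective _ (e j)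
      rw [← hp, rightMul_mk, rightMul_mk, rightMul_mk, AddMemClass.coe_add, mul_add,
        Submodule.Quotient.mk_add]
    simp [h]
  commutes' a := by
    ext j k
    have h : rightMul (algebraMap (fixedField σ) (idealiser (fixedField σ) f) a) (e j) =
        (a : K) • e j := by
      obtain ⟨p, hp⟩ := Submodule.Quotient.mk_surjective _ (e j)
      rw [← hp, rightMul_mk]
      change Submodule.Quotient.mk (p * const σ (a : K)) = Submodule.Quotient.mk (const σ (a : K) * p)
      rw [const_fixed_commutes]
    simp only [Matrix.of_apply, h, map_smul, e.repr_self, Finsupp.smul_apply, smul_eq_mul,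
      Finsupp.single_apply, Matrix.algebraMap_matrix_apply]
    split_ifs <;> simp

theorem toMatrixHom_surjective (hb : b ≠ 0) (e : Module.Basis ι K (SkewPoly σ ⧸ Ideal.span {f}))
    (he : ∀ j, t σ • e j = b • e j) : Function.Surjective (toMatrixHom hb e he) := by
  intro M
  obtain ⟨φ, hφ⟩ := exists_linearMap_of_matrix e he M
  obtain ⟨g, rfl⟩ := exists_eq_rightMul φ
  exact ⟨g, by ext j k; exact hφ j k⟩

theorem toMatrixHom_eq_zero_iff (hb : b ≠ 0) (e : Module.Basis ι K (SkewPoly σ ⧸ Ideal.span {f}))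
    (he : ∀ j, t σ • e j = b • e j) (g : idealiser (fixedField σ) f) :
    toMatrixHom hb e he g = 0 ↔ g ∈ idealiserIdeal (fixedField σ) f := by
  have hmem : g ∈ idealiserIdeal (fixedField σ) f ↔ rightMul g = 0 := by
    refine ⟨fun h => ?_, fun h => ?_⟩
    · refine LinearMap.ext fun v => ?_
      obtain ⟨p, rfl⟩ := Submodule.Quotient.mk_surjective _ v
      exact (Submodule.Quotient.mk_eq_zero _).2 (Ideal.mul_mem_left _ p h)
    · have h1 : (Submodule.Quotient.mk (1 * (g : SkewPoly σ)) : SkewPoly σ ⧸ Ideal.span {f}) = 0 :=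
        LinearMap.congr_fun h (Submodule.Quotient.mk 1)
      rw [one_mul] at h1
      change (g : SkewPoly σ) ∈ Ideal.span {f}
      exact (Submodule.Quotient.mk_eq_zero _).1 h1
  rw [hmem]
  refine ⟨fun h => ?_, fun h => ?_⟩
  · have hz : ∀ j, rightMul g (e j) = 0 := fun j => by
      apply e.repr.injective
      ext k
      rw [map_zero]
      exact congrArg Subtype.val (congrFun (congrFun h j) k)
    have : (rightMul g).restrictScalars K = 0 := e.ext hz
    refine LinearMap.ext fun v => ?_
    exact LinearMap.congr_fun this v
  · ext j k
    change e.repr (rightMul g (e j)) k = 0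
    rw [h]
    simp

/-- The eigenring is a full matrix algebra over `F` if `R ⧸ R f` has a basis of eigenvectors
of `t`. -/
def eigenringEquivMatrix (hb : b ≠ 0) (e : Module.Basis ι K (SkewPoly σ ⧸ Ideal.span {f}))
    (he : ∀ j, t σ • e j = b • e j) :
    Eigenring (fixedField σ) f ≃ₐ[fixedField σ] Matrix ι ι (fixedField σ) :=
  AlgEquiv.ofBijective
    (Ideal.Quotient.liftₐ _ (toMatrixHom hb e he)
      fun g hg => (toMatrixHom_eq_zero_iff hb e he g).2 hg) <| by
    constructor
    · rw [injective_iff_map_eq_zero]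
      intro x hx
      obtain ⟨g, rfl⟩ := Ideal.Quotient.mk_surjective x
      exact Ideal.Quotient.eq_zero_iff_mem.2 ((toMatrixHom_eq_zero_iff hb e he g).1 hx)
    · intro M
      obtain ⟨g, hg⟩ := toMatrixHom_surjective hb e he M
      exact ⟨Ideal.Quotient.mk _ g, hg⟩

/-- A K-basis of R/Rf can be extracted from the spanning eigenvectors, so the eigenring is a matrix
algebra over F of positive size. -/
theorem isGeneralisedAPolynomial_of_norm (hσ : orderOf σ = n) (hn : 0 < n) (hf : f ≠ 0)
    (hdeg : 0 < natDegree f) (hb : b ≠ 0)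
    (h : t σ ^ n - const σ (∏ i ∈ Finset.range n, (σ ^ i : K ≃+* K) b) ∈ Ideal.span {f}) :
    IsGeneralisedAPolynomial f := by
  classical
  have := finite_quotient hf
  have hspan := span_eigenvectors_quotient hσ hn hb h
  let e := Module.Basis.ofSpan hspan.ge
  have he : ∀ j, t σ • e j = b • e j := fun j =>
    Module.Basis.ofSpan_subset hspan.ge ⟨j, rfl⟩
  have : Fintype _ := FiniteDimensional.fintypeBasisIndex e
  have : Nontrivial (SkewPoly σ ⧸ Ideal.span {f}) :=
    Module.nontrivial_of_finrank_pos (R := K) (by rwa [finrank_quotient hf])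
  have := e.index_nonempty
  let E := eigenringEquivMatrix hb e he
  exact ⟨Module.Finite.equiv E.symm.toLinearEquiv, Algebra.IsCentral.of_algEquiv _ _ _ E.symm,
    IsSimpleRing.of_ringEquiv E.symm.toRingEquiv inferInstance⟩

end Eigenring

end SkewPoly

namespace SkewPoly

variable {K : Type*} [Field K] {σ : K ≃+* K} {n : ℕ} {f : SkewPoly σ}

/-! ### Linear factors of right divisors of t^n - N(b) -/

section Factorisation

/-- A twisted remainder theorem: modulo R(t - b), t^k reduces to b σ(b) ⋯ σ^(k-1)(b). -/
theorem t_pow_sub_norm_mem_span (b : K) (k : ℕ) :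
    t σ ^ k - const σ (∏ i ∈ Finset.range k, (σ ^ i : K ≃+* K) b) ∈
      Ideal.span {t σ - const σ b} := by
  induction k with
  | zero => simp
  | succ k ih =>
    have h : ∏ i ∈ Finset.range (k + 1), (σ ^ i : K ≃+* K) b =
        σ (∏ i ∈ Finset.range k, (σ ^ i : K ≃+* K) b) * b := by
      rw [Finset.prod_range_succ', map_prod]
      simp only [pow_succ']
      rfl
    rw [h]
    set P := ∏ i ∈ Finset.range k, (σ ^ i : K ≃+* K) b
    have heq : t σ ^ (k + 1) - const σ (σ P * b) =
        t σ * (t σ ^ k - const σ P) + const σ (σ P) * (t σ - const σ b) := by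
      rw [mul_sub, mul_sub, t_mul_const, map_mul, pow_succ']
      abel
    rw [heq]
    exact add_mem (Ideal.mul_mem_left _ _ ih)
      (Ideal.mul_mem_left _ _ (Ideal.mem_span_singleton_self _))

/-- The factor σ(c)c⁻¹ has norm 1. -/
theorem prod_range_Omega (hσ : orderOf σ = n) (c : Kˣ) (b : K) :
    ∏ i ∈ Finset.range n, (σ ^ i : K ≃+* K) (Omega σ c b) =
      ∏ i ∈ Finset.range n, (σ ^ i : K ≃+* K) b := by
  have hc : ∏ i ∈ Finset.range n, (σ ^ i : K ≃+* K) (c : K) ≠ 0 :=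
    Finset.prod_ne_zero_iff.2 fun i _ => (map_ne_zero_iff _ (RingEquiv.injective _)).2 c.ne_zero
  have h : ∏ i ∈ Finset.range n, (σ ^ i : K ≃+* K) (σ (c : K)) =
      ∏ i ∈ Finset.range n, (σ ^ i : K ≃+* K) (c : K) := by
    rw [← map_prod_range_orderOf hσ (c : K), map_prod]
    refine Finset.prod_congr rfl fun i _ => ?_
    change (σ ^ i * σ : K ≃+* K) (c : K) = (σ * σ ^ i : K ≃+* K) (c : K)
    rw [← pow_succ, ← pow_succ']
  simp only [Omega, map_mul, map_inv₀, Finset.prod_mul_distrib, Finset.prod_inv_distrib, h]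
  rw [mul_right_comm, mul_inv_cancel₀ hc, one_mul]

/-- A monic divisor of `t ^ n - N(b)` of positive degree has a left factor `t - Ω_c(b)`. -/
theorem exists_eq_linear_mul (hσ : orderOf σ = n) (hn : 0 < n) {m : ℕ} (hmonic : IsMonic f)
    (hdeg : natDegree f = m + 1) {b : K} (hb : b ≠ 0)
    (h : t σ ^ n - const σ (∏ i ∈ Finset.range n, (σ ^ i : K ≃+* K) b) ∈ Ideal.span {f}) :
    ∃ (c : Kˣ) (g : SkewPoly σ), IsMonic g ∧ natDegree g = m ∧
      f = (t σ - const σ (Omega σ c b)) * g := by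
  have hf := hmonic.ne_zero
  have : Nontrivial (SkewPoly σ ⧸ Ideal.span {f}) :=
    Module.nontrivial_of_finrank_pos (R := K) (by rw [finrank_quotient hf, hdeg]; omega)
  obtain ⟨w, hw, hw0⟩ : ∃ w : SkewPoly σ ⧸ Ideal.span {f}, t σ • w = b • w ∧ w ≠ 0 := by
    by_contra! hc
    have hspan := span_eigenvectors_quotient hσ hn hb h
    exact bot_ne_top ((Submodule.span_eq_bot.2 fun w hw => hc w hw).symm.trans hspan)
  obtain ⟨p, rfl⟩ := Submodule.Quotient.mk_surjective _ w
  obtain ⟨q, hq⟩ := exists_sub_mul hf p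
  -- The eigenvector is represented by r of degree at most m, and (t - b) r = s f. Comparing degrees
  -- forces s constant and deg r = m; comparing leading coefficients gives s = σ(u), with u that of
  -- r.
  set r := p - q * f with hr
  have hrp : (Submodule.Quotient.mk r : SkewPoly σ ⧸ Ideal.span {f}) = Submodule.Quotient.mk p := by
    refine (Submodule.Quotient.eq _).2 ?_
    rw [hr, sub_sub_cancel_left]
    exact neg_mem (Ideal.mul_mem_left _ _ (Ideal.mem_span_singleton_self f))
  rw [← hrp] at hw hw0
  have hr0 : r ≠ 0 := fun h0 => hw0 (by rw [h0, Submodule.Quotient.mk_zero])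
  have hmem : (t σ - const σ b) * r ∈ Ideal.span {f} := by
    rw [sub_mul]
    exact (Submodule.Quotient.eq _).1 hw
  obtain ⟨s, hs⟩ := Ideal.mem_span_singleton'.1 hmem
  have hlin : natDegree (t σ - const σ b) = 1 := by
    simpa using natDegree_t_pow_sub_const (σ := σ) one_pos b
  have hlin0 : t σ - const σ b ≠ 0 := fun h0 => by
    rw [h0, ← map_zero (const σ), natDegree_const] at hlin
    exact zero_ne_one hlin
  have hs0 : s ≠ 0 := left_ne_zero_of_mul (hs ▸ mul_ne_zero hlin0 hr0)
  have hrdeg : natDegree r < m + 1 :=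
    natDegree_lt_of_cf (Nat.succ_pos m) (hdeg ▸ hq)
  have hdegs := congrArg natDegree hs
  rw [natDegree_mul hs0 hf, natDegree_mul hlin0 hr0, hlin, hdeg] at hdegs
  have hsdeg : natDegree s = 0 := by omega
  have hrm : natDegree r = m := by omega
  have hu := cf_natDegree_ne_zero hr0
  rw [hrm] at hu
  set u := cf r m with hudef
  have hlead := cf_mul_natDegree (t σ - const σ b) r
  rw [← hs, hlin, hrm, add_comm 1 m, ← hdeg, eq_const_of_natDegree_eq_zero hsdeg, cf_const_mul,
    isMonic_iff.1 hmonic, mul_one, cf_sub, cf_const, if_neg zero_ne_one, sub_zero, ← pow_one (t σ),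
    cf_t_pow, if_pos rfl, one_mul, pow_one, ← hudef] at hlead
  rw [eq_const_of_natDegree_eq_zero hsdeg, hlead] at hs
  have hσu : σ u ≠ 0 := (map_ne_zero_iff _ σ.injective).2 hu
  have hgdeg : natDegree (const σ u⁻¹ * r) = m := by
    refine natDegree_eq ?_ fun i hi => ?_
    · rw [cf_const_mul]; exact mul_ne_zero (inv_ne_zero hu) hu
    · rw [cf_const_mul, cf_eq_zero_of_natDegree_lt (hrm ▸ hi), mul_zero]
  -- Making r monic conjugates the linear factor: σ(u)⁻¹ (t - b) u = t - Ω_{u⁻¹}(b).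
  refine ⟨(Units.mk0 u hu)⁻¹, const σ u⁻¹ * r, ?_, hgdeg, ?_⟩
  · rw [isMonic_iff, hgdeg, cf_const_mul, ← hudef, inv_mul_cancel₀ hu]
  · have hf' : f = const σ (σ u)⁻¹ * (const σ (σ u) * f) := by
      rw [← mul_assoc, ← map_mul, inv_mul_cancel₀ hσu, map_one, one_mul]
    rw [hf', hs, ← mul_assoc, ← mul_assoc]
    congr 1
    have hΩ : Omega σ (Units.mk0 u hu)⁻¹ b * u⁻¹ = (σ u)⁻¹ * b := by
      rw [Omega, Units.val_inv_eq_inv_val, Units.val_mk0, inv_inv, map_inv₀, mul_assoc _ u,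
        mul_inv_cancel₀ hu, mul_one]
    rw [mul_sub, sub_mul, t_mul_const, ← map_mul, ← map_mul, hΩ, map_inv₀ σ]

theorem exists_eq_prod_linear (hσ : orderOf σ = n) (hn : 0 < n) {b : K} (hb : b ≠ 0) (m : ℕ) :
    ∀ f : SkewPoly σ, IsMonic f → natDegree f = m →
      t σ ^ n - const σ (∏ i ∈ Finset.range n, (σ ^ i : K ≃+* K) b) ∈ Ideal.span {f} →
      ∃ c : Fin m → Kˣ,
        f = (List.ofFn fun i : Fin m => t σ - const σ (Omega σ (c i) b)).prod := by
  induction m with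
  | zero =>
    intro f hmonic hdeg _
    refine ⟨Fin.elim0, ?_⟩
    have h1 := isMonic_iff.1 hmonic
    rw [hdeg] at h1
    rw [eq_const_of_natDegree_eq_zero hdeg, h1, map_one]
    simp
  | succ m ih =>
    intro f hmonic hdeg h
    obtain ⟨c₀, g, hg, hgdeg, rfl⟩ := exists_eq_linear_mul hσ hn hmonic hdeg hb h
    obtain ⟨c, hc⟩ := ih g hg hgdeg <|
      (Ideal.span_singleton_le_iff_mem _).2
        (Ideal.mul_mem_left _ _ (Ideal.mem_span_singleton_self g)) h
    exact ⟨Fin.cons c₀ c, by simp [List.ofFn_succ, ← hc]⟩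

theorem Omega_div_Omega (c d : Kˣ) (b : K) :
    Omega σ (c / d) (Omega σ d b) = Omega σ c b := by
  have hd : σ (d : K) ≠ 0 := (map_ne_zero_iff _ σ.injective).2 d.ne_zero
  have hc := c.ne_zero
  have hd' := d.ne_zero
  simp only [Omega, Units.val_div_eq_div_val, map_div₀]
  field_simp

theorem Omega_ne_zero (c : Kˣ) {b : K} (hb : b ≠ 0) : Omega σ c b ≠ 0 :=
  mul_ne_zero (mul_ne_zero ((map_ne_zero_iff _ σ.injective).2 c.ne_zero) hb)
    (inv_ne_zero c.ne_zero)

/-- Replacing b by Ω_{c_m}(b) and each c_i by c_i/c_m leaves the factors unchanged and makes the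
last parameter 1. -/
theorem exists_normalised_prod_linear (hσ : orderOf σ = n) (hn : 0 < n) {b : K} (hb : b ≠ 0)
    {m : ℕ} (hm : 1 ≤ m) (hmonic : IsMonic f) (hdeg : natDegree f = m)
    (h : t σ ^ n - const σ (∏ i ∈ Finset.range n, (σ ^ i : K ≃+* K) b) ∈ Ideal.span {f}) :
    ∃ (c : Fin m → Kˣ) (b : Kˣ), (∀ i : Fin m, (i : ℕ) + 1 = m → c i = 1) ∧
      f = (List.ofFn fun i : Fin m => t σ - const σ (Omega σ (c i) (b : K))).prod := by
  obtain ⟨c, hc⟩ := exists_eq_prod_linear hσ hn hb m f hmonic hdeg h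
  let l : Fin m := ⟨m - 1, by omega⟩
  refine ⟨fun i => c i / c l, Units.mk0 (Omega σ (c l) b) (Omega_ne_zero (c l) hb), fun i hi => ?_, ?_⟩
  · have : i = l := Fin.ext (by simp only [l]; omega)
    exact this ▸ div_self' (c i)
  · simp only [Units.val_mk0, Omega_div_Omega]
    exact hc

end Factorisation

/-! ### The case where a is not a norm -/

section NonNorm

/-- A proper right factor h would give a module R/Rh of dimension strictly between 0 and the prime
n, hence coprime to n, making a a norm. -/
theorem irreducible_t_pow_sub_const (hn : n.Prime) (hσ : orderOf σ = n) {a : K} (ha0 : a ≠ 0)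
    (ha : σ a = a) (hN : ∀ b : K, ∏ i ∈ Finset.range n, (σ ^ i : K ≃+* K) b ≠ a) :
    Irreducible (t σ ^ n - const σ a) := by
  have hdeg := natDegree_t_pow_sub_const (σ := σ) hn.pos a
  have hz := (isMonic_t_pow_sub_const (σ := σ) hn.pos a).ne_zero
  refine ⟨fun h => ?_, fun {g h} hgh => ?_⟩
  · rw [isUnit_iff_natDegree_eq_zero hz, hdeg] at h
    exact hn.ne_zero h
  · have hg0 : g ≠ 0 := left_ne_zero_of_mul (hgh ▸ hz)
    have hh0 : h ≠ 0 := right_ne_zero_of_mul (hgh ▸ hz)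
    rw [hgh, natDegree_mul hg0 hh0] at hdeg
    rw [isUnit_iff_natDegree_eq_zero hg0, isUnit_iff_natDegree_eq_zero hh0]
    by_contra! hc
    have := finite_quotient hh0
    have hmem : t σ ^ n - const σ a ∈ Ideal.span {h} :=
      Ideal.mem_span_singleton'.2 ⟨g, hgh.symm⟩
    obtain ⟨b, hb⟩ := exists_prod_eq_of_coprime_finrank_quotient hσ ha0 ha hmem (by
      rw [finrank_quotient hh0]
      exact (Nat.coprime_of_lt_prime (by omega) (by omega) hn).symm)
    exact hN b hb

/-- The projection from `K[t;σ]` onto the eigenring of a central element. -/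
def eigenringProj (hf : ∀ g, f * g = g * f) :
    SkewPoly σ →ₐ[fixedField σ] Eigenring (fixedField σ) f :=
  (Ideal.Quotient.mkₐ (fixedField σ) (idealiserIdeal (fixedField σ) f)).comp
    ((AlgHom.id (fixedField σ) (SkewPoly σ)).codRestrict (idealiser (fixedField σ) f) fun g => by
      change f * g ∈ Ideal.span {f}
      rw [hf]
      exact Ideal.mul_mem_left _ g (Ideal.mem_span_singleton_self f))

theorem eigenringProj_surjective (hf : ∀ g, f * g = g * f) :
    Function.Surjective (eigenringProj hf) := by
  intro x
  obtain ⟨g, rfl⟩ := Ideal.Quotient.mk_surjective x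
  exact ⟨g, rfl⟩

theorem eigenringProj_eq_zero_iff (hf : ∀ g, f * g = g * f) (p : SkewPoly σ) :
    eigenringProj hf p = 0 ↔ p ∈ Ideal.span {f} :=
  Ideal.Quotient.eq_zero_iff_mem

theorem exists_eigenringProj_eq (hf : ∀ g, f * g = g * f) (hf0 : f ≠ 0)
    (x : Eigenring (fixedField σ) f) :
    ∃ p : SkewPoly σ, (∀ i, natDegree f ≤ i → cf p i = 0) ∧ eigenringProj hf p = x := by
  obtain ⟨p, rfl⟩ := eigenringProj_surjective hf x
  obtain ⟨q, hq⟩ := exists_sub_mul hf0 p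
  refine ⟨_, hq, ?_⟩
  rw [map_sub, (eigenringProj_eq_zero_iff hf _).2
    (Ideal.mul_mem_left _ q (Ideal.mem_span_singleton_self f)), sub_zero]

theorem finite_eigenring (hσ : orderOf σ = n) (hn : 0 < n) (hf : ∀ g, f * g = g * f)
    (hf0 : f ≠ 0) : Module.Finite (fixedField σ) (Eigenring (fixedField σ) f) := by
  have := finite_fixedField hσ hn
  let L : (Fin (natDegree f) → K) →ₗ[fixedField σ] Eigenring (fixedField σ) f :=
    { toFun := fun c => eigenringProj hf (∑ i, const σ (c i) * t σ ^ (i : ℕ))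
      map_add' := fun c d => by
        rw [← map_add, ← Finset.sum_add_distrib]
        simp only [Pi.add_apply, map_add, add_mul]
      map_smul' := fun a c => by
        refine Eq.trans (congrArg (eigenringProj hf) ?_) ((eigenringProj hf).toLinearMap.map_smul a _)
        change _ = const σ (a : K) * _
        rw [Finset.mul_sum]
        refine Finset.sum_congr rfl fun i _ => ?_
        rw [← mul_assoc]
        exact congrArg (· * t σ ^ (i : ℕ)) ((const σ).map_mul (a : K) (c i)) }
  refine Module.Finite.of_surjective L fun x => ?_
  obtain ⟨p, hp, rfl⟩ := exists_eigenringProj_eq hf hf0 x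
  refine ⟨fun i => cf p i, congrArg (eigenringProj hf) ?_⟩
  refine Eq.trans ?_ (sum_const_mul_t_pow p hp).symm
  exact Fin.sum_univ_eq_sum_range (fun i => const σ (cf p i) * t σ ^ i) _

/-- For a reduced representative p, commuting with constants kills each coefficient in degree 0 < i
< n because σ^i ≠ 1; commuting with t then puts the constant coefficient in F. -/
theorem isCentral_eigenring (hσ : orderOf σ = n) (hn : 1 < n) (hf : ∀ g, f * g = g * f)
    (hf0 : f ≠ 0) (hdeg : natDegree f = n) :
    Algebra.IsCentral (fixedField σ) (Eigenring (fixedField σ) f) := by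
  refine ⟨fun x hx => ?_⟩
  obtain ⟨p, hp, rfl⟩ := exists_eigenringProj_eq hf hf0 x
  have hcomm : ∀ g : SkewPoly σ, g * p - p * g ∈ Ideal.span {f} := by
    intro g
    rw [← eigenringProj_eq_zero_iff hf, map_sub, map_mul, map_mul,
      Subalgebra.mem_center_iff.1 hx, sub_self]
  have hconst : ∀ (c : K) (i : ℕ), c * cf p i = cf p i * (σ ^ i : K ≃+* K) c := by
    intro c i
    have hz : ∀ i, cf (const σ c * p - p * const σ c) i =
        c * cf p i - cf p i * (σ ^ i : K ≃+* K) c := by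
      intro i
      rw [cf_sub, cf_const_mul, cf_mul, Finset.sum_eq_single (i, 0)]
      · rw [cf_const, if_pos rfl]
      · rintro ⟨j, k⟩ hjk hne
        rw [Finset.HasAntidiagonal.mem_antidiagonal] at hjk
        have : 0 ≠ k := by
          rintro rfl
          exact hne (by rw [← hjk]; rfl)
        simp [cf_const, this]
      · simp
    have h0 := eq_zero_of_mem_span (hcomm (const σ c)) fun i hi => by
      rw [hz, hp i hi, mul_zero, zero_mul, sub_zero]
    have := hz i
    rw [h0, cf_zero] at this
    exact (sub_eq_zero.1 this.symm)
  have hpi : ∀ i, 0 < i → cf p i = 0 := by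
    intro i hi
    rcases lt_or_ge i n with hin | hin
    · by_contra hne
      have h1 : σ ^ i = 1 := RingEquiv.ext fun c => by
        have := hconst c i
        rw [mul_comm] at this
        exact (mul_left_cancel₀ hne this).symm
      have := orderOf_le_of_pow_eq_one hi h1
      omega
    · exact hp i (hdeg ▸ hin)
  have hpc : p = const σ (cf p 0) := by
    refine eq_const_of_natDegree_eq_zero (Nat.le_zero.1 (natDegree_le_iff.2 hpi))
  have hfix : σ (cf p 0) = cf p 0 := by
    have hmem := hcomm (t σ)
    have heq : t σ * p - p * t σ = const σ (σ (cf p 0) - cf p 0) * t σ ^ 1 := by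
      conv_lhs => rw [hpc]
      rw [t_mul_const, map_sub, sub_mul, pow_one]
    -- The commutator with t has degree at most 1, below deg f = n, so it vanishes outright.
    rw [heq] at hmem
    have h0 := eq_zero_of_mem_span hmem fun i hi => by
      rw [cf_const_mul, cf_t_pow, if_neg (by omega), mul_zero]
    have h1 := congrArg (fun q => cf q 1) h0
    simp only [cf_const_mul, cf_t_pow, if_true, mul_one, cf_zero] at h1
    exact sub_eq_zero.1 h1
  refine Algebra.mem_bot.2 ⟨⟨cf p 0, hfix⟩, ?_⟩
  exact ((eigenringProj hf).commutes ⟨cf p 0, hfix⟩).symm.trans (congrArg (eigenringProj hf) hpc.symm)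

/-- An ideal pulls back to a left ideal J containing Rf. If dim R/J were strictly between 0 and n,
the determinant argument would make a a norm; dimension 0 gives the whole ring and dimension n gives
J = Rf. -/
theorem isSimpleRing_eigenring (hn : n.Prime) (hσ : orderOf σ = n) {a : K} (ha0 : a ≠ 0)
    (ha : σ a = a) (hN : ∀ b : K, ∏ i ∈ Finset.range n, (σ ^ i : K ≃+* K) b ≠ a)
    (hfa : f = t σ ^ n - const σ a) (hf : ∀ g, f * g = g * f) (hf0 : f ≠ 0)
    (hdeg : natDegree f = n) : IsSimpleRing (Eigenring (fixedField σ) f) := by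
  have : Nontrivial (Eigenring (fixedField σ) f) := by
    refine ⟨⟨1, 0, fun h => ?_⟩⟩
    rw [← map_one (eigenringProj hf), eigenringProj_eq_zero_iff] at h
    obtain ⟨q, hq⟩ := Ideal.mem_span_singleton'.1 h
    have hq0 : q ≠ 0 := by rintro rfl; simp at hq
    have := natDegree_mul hq0 hf0
    rw [hq, ← map_one (const σ), natDegree_const, hdeg] at this
    exact hn.ne_zero (by omega)
  rw [isSimpleRing_iff_isTwoSided_imp]
  refine ⟨this, fun I _ => ?_⟩
  let J : Ideal (SkewPoly σ) := I.comap (eigenringProj hf)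
  have hle : Ideal.span {f} ≤ J := by
    refine (Ideal.span_singleton_le_iff_mem _).2 ?_
    change eigenringProj hf f ∈ I
    rw [(eigenringProj_eq_zero_iff hf f).2 (Ideal.mem_span_singleton_self f)]
    exact I.zero_mem
  have := finite_quotient hf0
  let φ : (SkewPoly σ ⧸ Ideal.span {f}) →ₗ[K] SkewPoly σ ⧸ J :=
    (Submodule.factor hle).restrictScalars K
  have hφ : Function.Surjective φ := Submodule.factor_surjective hle
  have hJfin : Module.Finite K (SkewPoly σ ⧸ J) := Module.Finite.of_surjective φ hφ
  have hrank : Module.finrank K (SkewPoly σ ⧸ J) ≤ n := by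
    rw [← hdeg, ← finrank_quotient hf0]
    exact LinearMap.finrank_le_finrank_of_surjective hφ
  rcases Nat.eq_zero_or_pos (Module.finrank K (SkewPoly σ ⧸ J)) with h0 | hpos
  · right
    have hsub : Subsingleton (SkewPoly σ ⧸ J) := Module.finrank_zero_iff.1 h0
    rw [Ideal.eq_top_iff_one]
    have : (Submodule.Quotient.mk 1 : SkewPoly σ ⧸ J) = 0 := Subsingleton.elim _ _
    have h1 : eigenringProj hf 1 ∈ I := (Submodule.Quotient.mk_eq_zero J).1 this
    rwa [map_one] at h1
  rcases hrank.lt_or_eq with hlt | heq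
  · have hmem : t σ ^ n - const σ a ∈ J := hfa ▸ hle (Ideal.mem_span_singleton_self f)
    obtain ⟨b, hb⟩ := exists_prod_eq_of_coprime_finrank_quotient hσ ha0 ha hmem
      (Nat.coprime_of_lt_prime hpos.ne' hlt hn).symm
    exact absurd hb (hN b)
  · left
    have hinj : Function.Injective φ :=
      (LinearMap.injective_iff_surjective_of_finrank_eq_finrank
        (by rw [finrank_quotient hf0, hdeg, heq])).2 hφ
    rw [eq_bot_iff]
    intro x hx
    obtain ⟨p, rfl⟩ := eigenringProj_surjective hf x
    refine (eigenringProj_eq_zero_iff hf p).2 ((Submodule.Quotient.mk_eq_zero _).1 (hinj ?_))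
    rw [map_zero]
    exact (Submodule.Quotient.mk_eq_zero J).2 hx

theorem isGeneralisedAPolynomial_t_pow_sub_const (hn : n.Prime) (hσ : orderOf σ = n) {a : K}
    (ha0 : a ≠ 0) (ha : σ a = a)
    (hN : ∀ b : K, ∏ i ∈ Finset.range n, (σ ^ i : K ≃+* K) b ≠ a) :
    IsGeneralisedAPolynomial (t σ ^ n - const σ a) := by
  have hf := t_pow_sub_const_mul_comm hσ ha
  have hf0 := (isMonic_t_pow_sub_const (σ := σ) hn.pos a).ne_zero
  have hdeg := natDegree_t_pow_sub_const (σ := σ) hn.pos a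
  exact ⟨finite_eigenring hσ hn.pos hf hf0, isCentral_eigenring hσ hn.one_lt hf hf0 hdeg,
    isSimpleRing_eigenring hn hσ ha0 ha hN rfl hf hf0 hdeg⟩

end NonNorm

/-! ### Scalar action of t^n and the minimal central left multiple -/

section CentralMultiple

/-- Otherwise t would be a nonunit common right divisor of f and t. -/
theorem cf_zero_ne_zero_of_isRightCoprime (hft : IsRightCoprime f (t σ)) : cf f 0 ≠ 0 := by
  intro h0
  obtain ⟨q, hq⟩ := exists_eq_mul_t_add_const f
  rw [h0, map_zero, add_zero] at hq
  have hu := hft (t σ) (Ideal.mem_span_singleton'.2 ⟨q, hq.symm⟩) (Ideal.mem_span_singleton_self _)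
  have ht0 : t σ ≠ 0 := SkewPolynomial.X_ne_zero
  rw [isUnit_iff_natDegree_eq_zero ht0] at hu
  have : natDegree (t σ) = 1 := natDegree_eq (by rw [← pow_one (t σ), cf_t_pow]; simp)
    fun i hi => by rw [← pow_one (t σ), cf_t_pow, if_neg hi.ne]
  omega

/-- In q f the lowest term of q meets the nonzero constant term of f, and the leading terms meet as
well. As deg f > 0, these are nonzero coefficients in two different degrees, so q f is not a power
of t. -/
theorem t_pow_notMem_span (h0 : cf f 0 ≠ 0) (hdeg : 0 < natDegree f) (k : ℕ) :
    t σ ^ k ∉ Ideal.span {f} := by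
  classical
  intro h
  obtain ⟨q, hq⟩ := Ideal.mem_span_singleton'.1 h
  have hf0 : f ≠ 0 := by rintro rfl; exact h0 rfl
  have hq0 : q ≠ 0 := by
    rintro rfl
    have := congrArg (fun p => cf p k) hq
    simp [cf_t_pow] at this
  have hex : ∃ i, cf q i ≠ 0 := ⟨_, cf_natDegree_ne_zero hq0⟩
  have hi : cf (q * f) (Nat.find hex) ≠ 0 := by
    rw [cf_mul, Finset.sum_eq_single (Nat.find hex, 0)]
    · exact mul_ne_zero (Nat.find_spec hex) ((map_ne_zero_iff _ (RingEquiv.injective _)).2 h0)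
    · rintro ⟨i, j⟩ hij hne
      rw [Finset.HasAntidiagonal.mem_antidiagonal] at hij
      have hlt : i < Nat.find hex := by
        rcases Nat.eq_zero_or_pos j with rfl | hj
        · exact absurd (by rw [← hij]; rfl) hne
        · simp only at hij; omega
      rw [not_not.1 (Nat.find_min hex hlt), zero_mul]
    · simp
  have hle : Nat.find hex ≤ natDegree q := Nat.find_min' hex (cf_natDegree_ne_zero hq0)
  have htop := cf_mul_natDegree_ne_zero hq0 hf0
  rw [hq, cf_t_pow] at hi htop
  have h1 : k = Nat.find hex := by by_contra hc; exact hi (if_neg hc)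
  have h2 : k = natDegree q + natDegree f := by by_contra hc; exact htop (if_neg hc)
  omega

/-- The class of `t ^ n` is a nonzero scalar if the eigenring is central. -/
theorem exists_t_pow_sub_const_mem (hσ : orderOf σ = n) (h0 : cf f 0 ≠ 0)
    (hdeg : 0 < natDegree f)
    (h : Algebra.IsCentral (fixedField σ) (Eigenring (fixedField σ) f)) :
    ∃ a : fixedField σ, a ≠ 0 ∧ t σ ^ n - const σ (a : K) ∈ Ideal.span {f} := by
  let g : idealiser (fixedField σ) f := ⟨t σ ^ n, by
    change f * t σ ^ n ∈ Ideal.span {f}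
    rw [← t_pow_mul_comm hσ]
    exact Ideal.mul_mem_left _ _ (Ideal.mem_span_singleton_self f)⟩
  have hg : (Ideal.Quotient.mk (idealiserIdeal (fixedField σ) f) g) ∈
      Subalgebra.center (fixedField σ) (Eigenring (fixedField σ) f) := by
    rw [Subalgebra.mem_center_iff]
    intro x
    obtain ⟨p, rfl⟩ := Ideal.Quotient.mk_surjective x
    rw [← map_mul, ← map_mul]
    exact congrArg _ (Subtype.ext (t_pow_mul_comm hσ (p : SkewPoly σ)).symm)
  obtain ⟨a, ha⟩ := Algebra.mem_bot.1 (h.out hg)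
  have hmem : t σ ^ n - const σ (a : K) ∈ Ideal.span {f} := by
    have h1 : Ideal.Quotient.mk (idealiserIdeal (fixedField σ) f) g =
        Ideal.Quotient.mk (idealiserIdeal (fixedField σ) f)
          (algebraMap (fixedField σ) (idealiser (fixedField σ) f) a) := ha.symm
    have h2 : g - algebraMap (fixedField σ) (idealiser (fixedField σ) f) a ∈
        idealiserIdeal (fixedField σ) f := Ideal.Quotient.eq.1 h1
    exact h2
  refine ⟨a, ?_, hmem⟩
  rintro rfl
  rw [ZeroMemClass.coe_zero, map_zero, sub_zero] at hmem
  exact t_pow_notMem_span h0 hdeg n hmem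

theorem cf_aeval (p : Polynomial (fixedField σ)) (k : ℕ) :
    cf (Polynomial.aeval (t σ ^ n) p) k =
      ∑ i ∈ Finset.range (p.natDegree + 1), if n * i = k then (p.coeff i : K) else 0 := by
  rw [Polynomial.aeval_eq_sum_range]
  change lcf k _ = _
  rw [map_sum]
  refine Finset.sum_congr rfl fun i _ => ?_
  change cf (const σ (p.coeff i : K) * (t σ ^ n) ^ i) k = _
  rw [cf_const_mul, ← pow_mul, cf_t_pow, mul_ite, mul_one, mul_zero]

theorem cf_aeval_natDegree (hn : 0 < n) (p : Polynomial (fixedField σ)) :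
    cf (Polynomial.aeval (t σ ^ n) p) (n * p.natDegree) = p.leadingCoeff := by
  rw [cf_aeval, Finset.sum_eq_single p.natDegree]
  · rw [if_pos rfl]; rfl
  · intro i _ hi
    exact if_neg fun h => hi (Nat.eq_of_mul_eq_mul_left hn h)
  · simp

theorem cf_aeval_natDegree_ne_zero (hn : 0 < n) {p : Polynomial (fixedField σ)} (hp : p ≠ 0) :
    cf (Polynomial.aeval (t σ ^ n) p) (n * p.natDegree) ≠ 0 := by
  rw [cf_aeval_natDegree hn]
  exact fun h => hp (Polynomial.leadingCoeff_eq_zero.1 (Subtype.ext h))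

theorem natDegree_aeval (hn : 0 < n) {p : Polynomial (fixedField σ)} (hp : p ≠ 0) :
    natDegree (Polynomial.aeval (t σ ^ n) p) = n * p.natDegree := by
  refine natDegree_eq (cf_aeval_natDegree_ne_zero hn hp) fun k hk => ?_
  rw [cf_aeval]
  refine Finset.sum_eq_zero fun i hi => if_neg ?_
  have := Nat.mul_le_mul_left n (Nat.lt_succ_iff.1 (Finset.mem_range.1 hi))
  omega

theorem aeval_mem_center (hσ : orderOf σ = n) (p : Polynomial (fixedField σ)) :
    Polynomial.aeval (t σ ^ n) p ∈ Subring.center (SkewPoly σ) := by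
  have ht : t σ ^ n ∈ Subalgebra.center (fixedField σ) (SkewPoly σ) :=
    Subalgebra.mem_center_iff.2 fun q => (t_pow_mul_comm hσ q).symm
  have : Polynomial.aeval (t σ ^ n) p ∈ Subalgebra.center (fixedField σ) (SkewPoly σ) := by
    rw [Polynomial.aeval_eq_sum_range]
    exact sum_mem fun i _ => Subalgebra.smul_mem _ (pow_mem ht i) _
  exact Subring.mem_center_iff.2 (Subalgebra.mem_center_iff.1 this)

/-- The remainder of p modulo `hhat` still evaluates into Rf and is central. Evaluation at t^n
multiplies degrees by n, so minimality forces the remainder to be zero. -/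
theorem IsMinimalCentralLeftMultiple.dvd (hσ : orderOf σ = n) (hn : 0 < n)
    {hhat : Polynomial (fixedField σ)} (hmin : IsMinimalCentralLeftMultiple n f hhat)
    {p : Polynomial (fixedField σ)} (hp : Polynomial.aeval (t σ ^ n) p ∈ Ideal.span {f}) :
    hhat ∣ p := by
  rw [← Polynomial.modByMonic_eq_zero_iff_dvd hmin.monic]
  by_contra hr
  have hmem : Polynomial.aeval (t σ ^ n) (p %ₘ hhat) ∈ Ideal.span {f} := by
    have h := Polynomial.modByMonic_add_div p hhat
    rw [mul_comm] at h
    rw [eq_sub_of_add_eq h, map_sub, map_mul]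
    exact sub_mem hp (Ideal.mul_mem_left _ _ hmin.left_multiple)
  have hle := hmin.minimal _ (aeval_mem_center hσ _)
    (fun h0 => cf_aeval_natDegree_ne_zero hn hr (by rw [h0, cf_zero])) hmem
  rw [natDegree_aeval hn hr, natDegree_aeval hn hmin.monic.ne_zero] at hle
  have hlt := Polynomial.natDegree_lt_natDegree hr (Polynomial.degree_modByMonic_lt p hmin.monic)
  exact absurd (Nat.le_of_mul_le_mul_left hle hn) (not_le.2 hlt)

/-- Being central, z can be moved next to each factor in turn and absorbed there, at the cost of one
copy of z per factor. -/
theorem pow_length_mem_span_prod {R : Type*} [Ring R] {z : R} (hz : ∀ x, z * x = x * z)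
    (L : List R) (hL : ∀ l ∈ L, z ∈ Ideal.span {l}) : z ^ L.length ∈ Ideal.span {L.prod} := by
  induction L with
  | nil => simp
  | cons l L ih =>
    obtain ⟨q, hq⟩ := Ideal.mem_span_singleton'.1 (ih fun x hx => hL x (List.mem_cons_of_mem l hx))
    obtain ⟨q', hq'⟩ := Ideal.mem_span_singleton'.1 (hL l List.mem_cons_self)
    refine Ideal.mem_span_singleton'.2 ⟨q * q', ?_⟩
    rw [List.prod_cons, List.length_cons, pow_succ', ← hq, ← mul_assoc z, hz q, ← hq']
    simp only [mul_assoc]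

/-- All factors right-divide the same z = t^n - N(b), so `hhat` divides (x - N(b))^m; being
square-free it divides x - N(b). -/
theorem t_pow_sub_norm_mem_of_squarefree (hσ : orderOf σ = n) (hn : 0 < n)
    {hhat : Polynomial (fixedField σ)} (hmin : IsMinimalCentralLeftMultiple n f hhat)
    (hsq : Squarefree hhat) {m : ℕ} (hm : m ≠ 0) (c : Fin m → Kˣ) (b : K)
    (hf : f = (List.ofFn fun i : Fin m => t σ - const σ (Omega σ (c i) b)).prod) :
    t σ ^ n - const σ (∏ i ∈ Finset.range n, (σ ^ i : K ≃+* K) b) ∈ Ideal.span {f} := by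
  let a : fixedField σ := ⟨_, map_prod_range_orderOf hσ b⟩
  have haeval : Polynomial.aeval (t σ ^ n) (Polynomial.X - Polynomial.C a) =
      t σ ^ n - const σ (a : K) := by
    rw [map_sub, Polynomial.aeval_X, Polynomial.aeval_C]
    rfl
  have hpow := pow_length_mem_span_prod (t_pow_sub_const_mul_comm hσ a.2)
    (List.ofFn fun i : Fin m => t σ - const σ (Omega σ (c i) b)) fun l hl => by
      obtain ⟨i, rfl⟩ := (List.mem_ofFn' _ _).1 hl
      have := t_pow_sub_norm_mem_span (σ := σ) (Omega σ (c i) b) n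
      rwa [prod_range_Omega hσ] at this
  rw [← hf, List.length_ofFn, ← haeval, ← map_pow] at hpow
  obtain ⟨q, hq⟩ := (hsq.dvd_pow_iff_dvd hm).1 (hmin.dvd hσ hn hpow)
  change t σ ^ n - const σ (a : K) ∈ _
  rw [← haeval, hq, mul_comm, map_mul]
  exact Ideal.mul_mem_left _ _ hmin.left_multiple

end CentralMultiple

end SkewPoly

end

/-! ### The equivalence and irreducibility -/

theorem corollary6 {K : Type*} [Field K] (σ : K ≃+* K) (n : ℕ) (hn : n.Prime)
    (hσ : orderOf σ = n) (f : SkewPoly σ) (m : ℕ) (hm : SkewPoly.natDegree f = m) (hm1 : 1 ≤ m)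
    (hmonic : SkewPoly.IsMonic f) (hft : SkewPoly.IsRightCoprime f (SkewPoly.t σ))
    (hhat : Polynomial (SkewPoly.fixedField σ))
    (hmin : SkewPoly.IsMinimalCentralLeftMultiple n f hhat) (hsq : Squarefree hhat) :
    (IsGeneralisedAPolynomial f ↔
      (∃ a : SkewPoly.fixedField σ, a ≠ 0 ∧
        (∀ b : K, a ≠ Algebra.norm (SkewPoly.fixedField σ) b) ∧
        f = SkewPoly.t σ ^ n - SkewPoly.const σ (a : K)) ∨
      (m ≤ n ∧ ∃ (c : Fin m → Kˣ) (b : Kˣ),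
        (∀ i : Fin m, (i : ℕ) + 1 = m → c i = 1) ∧
        f = (List.ofFn fun i : Fin m =>
          SkewPoly.t σ - SkewPoly.const σ (SkewPoly.Omega σ (c i) (b : K))).prod)) ∧
    (∀ a : SkewPoly.fixedField σ, a ≠ 0 →
      (∀ b : K, a ≠ Algebra.norm (SkewPoly.fixedField σ) b) →
      f = SkewPoly.t σ ^ n - SkewPoly.const σ (a : K) → Irreducible f) := by
  have hnorm : ∀ a : SkewPoly.fixedField σ,
      (∀ b : K, a ≠ Algebra.norm (SkewPoly.fixedField σ) b) →
      ∀ b : K, ∏ i ∈ Finset.range n, (σ ^ i : K ≃+* K) b ≠ a := fun a ha b hb =>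
    ha b (Subtype.ext (by rw [SkewPoly.coe_norm_eq_prod hσ hn.pos, hb]))
  have hcoe : ∀ a : SkewPoly.fixedField σ, a ≠ 0 → (a : K) ≠ 0 := fun a ha h =>
    ha (Subtype.ext h)
  refine ⟨⟨fun h => ?_, ?_⟩, ?_⟩
  · obtain ⟨a, ha0, hmem⟩ := SkewPoly.exists_t_pow_sub_const_mem hσ
      (SkewPoly.cf_zero_ne_zero_of_isRightCoprime hft) (by omega) h.central
    have hf0 := hmonic.ne_zero
    have htmonic := SkewPoly.isMonic_t_pow_sub_const (σ := σ) hn.pos (a : K)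
    have htdeg := SkewPoly.natDegree_t_pow_sub_const (σ := σ) hn.pos (a : K)
    obtain ⟨q, hq⟩ := Ideal.mem_span_singleton'.1 hmem
    have hq0 : q ≠ 0 := left_ne_zero_of_mul (hq ▸ htmonic.ne_zero)
    have hdeg := SkewPoly.natDegree_mul hq0 hf0
    rw [hq, htdeg, hm] at hdeg
    -- In t^n - a = q f, irreducibility when a is not a norm makes q a unit, and monicity makes it
    -- 1; if a = N(b), the descent argument factors f.
    by_cases hN : ∀ b : K, a ≠ Algebra.norm (SkewPoly.fixedField σ) b
    · refine Or.inl ⟨a, ha0, hN, ?_⟩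
      have hqu : IsUnit q := by
        have hirr := SkewPoly.irreducible_t_pow_sub_const hn hσ (hcoe a ha0) a.2 (hnorm a hN)
        refine (hirr.isUnit_or_isUnit hq.symm).resolve_right fun hu => ?_
        rw [SkewPoly.isUnit_iff_natDegree_eq_zero hf0] at hu
        omega
      rw [SkewPoly.isUnit_iff_natDegree_eq_zero hq0] at hqu
      have hlead := SkewPoly.isMonic_iff.1 htmonic
      rw [htdeg, ← hq, SkewPoly.eq_const_of_natDegree_eq_zero hqu, SkewPoly.cf_const_mul,
        show n = SkewPoly.natDegree f by omega, SkewPoly.isMonic_iff.1 hmonic, mul_one] at hlead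
      rw [← hq, SkewPoly.eq_const_of_natDegree_eq_zero hqu, hlead, map_one, one_mul]
    · push Not at hN
      obtain ⟨b, hb⟩ := hN
      have hab : (a : K) = ∏ i ∈ Finset.range n, (σ ^ i : K ≃+* K) b := by
        rw [hb, SkewPoly.coe_norm_eq_prod hσ hn.pos]
      have hb0 : b ≠ 0 := by
        rintro rfl
        exact ha0 (hb.trans (by
          apply Subtype.ext
          rw [SkewPoly.coe_norm_eq_prod hσ hn.pos]
          exact Finset.prod_eq_zero (Finset.mem_range.2 hn.pos) (map_zero _)))
      rw [hab] at hmem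
      exact Or.inr ⟨by omega,
        SkewPoly.exists_normalised_prod_linear hσ hn.pos hb0 hm1 hmonic hm hmem⟩
  · rintro (⟨a, ha0, hN, rfl⟩ | ⟨_, c, b, _, hf⟩)
    · exact SkewPoly.isGeneralisedAPolynomial_t_pow_sub_const hn hσ (hcoe a ha0) a.2 (hnorm a hN)
    · exact SkewPoly.isGeneralisedAPolynomial_of_norm hσ hn.pos hmonic.ne_zero (by omega) b.ne_zero
        (SkewPoly.t_pow_sub_norm_mem_of_squarefree hσ hn.pos hmin hsq (by omega) c b hf)
  · rintro a ha0 hN rfl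
    exact SkewPoly.irreducible_t_pow_sub_const hn hσ (hcoe a ha0) a.2 (hnorm a hN)
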